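/- Let $H$ be a real Hilbert space, $\mathsf A:H\to 2^H$ a maximal monotone operator with zero set $S=\mathsf A^{-1}(0)\neq\emptyset$, and $J_\sigma=(I+\sigma\mathsf A)^{-1}$ ($\sigma>0$) its resolvent functions. Let $(c_n)\subset(0,\infty)$, $(\lambda_n),(\delta_n)\subset(0,1)$, $(\gamma_n)\subset[0,1)$ with $\lambda_n+\gamma_n+\delta_n=1$ for all $n\in\mathbb N=\{0,1,2,\dots\}$, let $u,y_0\in H$, and $$y_{n+1}=\lambda_nu+\gamma_ny_n+\delta_nJ_{c_n}(y_n)\qquad(n\in\mathbb N).$$ Call a function $\mathbb N\to\mathbb N$ monotone if it is nondecreasing. Assume that there are $c\in\mathbb N\setminus\{0\}$ and monotone functions $h:\mathbb N\to\mathbb N\setminus\{0\}$ and $\ell,L:\mathbb N\to\mathbb N$ such that - $\lambda_n\ge\frac1{h(n)}$ for all $n$; - $\lambda_n\le\frac1{k+1}$ for all $k$ and all $n\ge\ell(k)$; - $\sum_{i=1}^{L(k)}\lambda_i\ge k$ for all $k$; - $\min\{c_n,\delta_n^2\}\ge\frac1c$ for all $n$. Let $D\in\mathbb N\setminus\{0\}$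 satisfy $D\ge\max\{2\|u-p\|,\|y_0-p\|\}$ for some $p\in S$, and let $\mathsf C:\mathbb N\to\mathbb N$ be a monotone function with $c_n\le\mathsf C(n)$ for all $n$. Then for all $k\in\mathbb N$ and all monotone $f:\mathbb N\to\mathbb N$, $$\exists n\le\mu(4(k+1)^2-1,f)\ \ \forall i,j\in[n,f(n)]\quad \|y_i-y_j\|\le\frac1{k+1}.$$ Here the function $\mu$, which depends only on $c,\mathsf C,h,\ell,L,D$, is given as follows ($g^{(m)}$ denotes the $m$-fold iterate of $g$, and $g+2$ the function $n\mapsto g(n)+2$). For $k,n,m\in\mathbb N$ and $f,g:\mathbb N\to\mathbb N$ put - $\zeta(k,n)=c(k+1)\mathsf C(n)-1$, $\quad\overline\sigma(k,n)=L\big(n+\lceil\ln(12D^2(k+1))\rceil\big)+1$; - $\phi_2(k,n,g)=\max\{n,g^{(4D^2(k+1))}(n)\}$, $\quad\phi_1(k,n,g)=g(\phi_2(k,n,g))$; - $w_g(m)=\max\{g(24D(m+1)^2),24D(m+1)^2\}$, $\quad\beta(k,g)=24D\big(w_g^{(4D^4(k+1)^2)}(0)+1\big)^2$; and, for given $k$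 and $f$, - $\widetilde f(n)=f(\overline\sigma(k,n))$, $\quad r_1(n)=12c(n+1)^2-1$, $\quad r_2(n)=\max\{2(n+1),128D(k+1)^2\}$; - $r_3(n)=\ell\big(\max\{96cD^2(n+1)^2-1,\;256D^2(k+1)^2-1,\;16c\,r_2(n)^2D^2\}\big)$; - $r_4(n)=3(k+1)\big(\widetilde f(\phi_2(r_1(n),r_3(n),\widetilde f+2))+1\big)$, $\quad\Phi(n)=\phi_1(r_1(n),r_3(n),\widetilde f+2)$; - $\Xi_1(n)=\zeta\big(2(6D+1)\max\{r_1(n),r_4(n)\}-1,\;\Phi(n)\big)$; - $\xi(n)=\zeta\big(\max\{16h(f(n))(k+1)^2(6D+1),\;4c\,r_2(n)^2(6D+1)\},\;f(n)\big)$; - $\Xi_2(n)=\xi(\Phi(n))$, $\quad\Xi(n)=\max\{\Xi_1(n),\Xi_2(n)\}$. With $b=\beta(32(k+1)^2-1,\Xi)$, $$\mu(k,f)=\max\big\{\overline\sigma\big(k,\phi_2(r_1(b),r_3(b),\widetilde f+2)\big),\ \Phi(b)\big\}.$$ -/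

import Mathlib

namespace MPPA

section Operators

variable {H : Type*} [NormedAddCommGroup H] [InnerProductSpace ℝ H]

/-- A set-valued operator `A : H → 2^H` is monotone. -/
def IsMonotoneOp (A : H → Set H) : Prop :=
  ∀ x x' y y' : H, y ∈ A x → y' ∈ A x' → 0 ≤ inner ℝ (x - x') (y - y')

/-- A monotone operator whose graph is not properly contained in the graph of another
monotone operator. -/
def IsMaximalMonotoneOp (A : H → Set H) : Prop :=
  IsMonotoneOp A ∧ ∀ B : H → Set H, IsMonotoneOp B → (∀ x, A x ⊆ B x) → ∀ x, B x ⊆ A x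

/-- The set `S = A⁻¹(0)` of zeros of `A`. -/
def zeros (A : H → Set H) : Set H := {x | (0 : H) ∈ A x}

open Classical in
/-- The resolvent function `J_σ = (I + σ A)⁻¹`: `J_σ x` is the point `w` with
`x ∈ w + σ A w`. For `σ > 0` there is at most one such `w` when `A` is monotone (see
`resolventFun_eq`), and there is one for every `x` when `A` is maximal monotone and `H` is a
Hilbert space, so the default value is never used there. -/
noncomputable def resolventFun (A : H → Set H) (σ : ℝ) (x : H) : H :=
  if hx : ∃ w : H, ∃ a ∈ A w, w + σ • a = x then hx.choose else x

theorem resolventFun_eq {A : H → Set H} (hA : IsMonotoneOp A) {σ : ℝ} (hσ : 0 < σ)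
    {x w a : H} (ha : a ∈ A w) (hx : w + σ • a = x) : resolventFun A σ x = w := by
  have hex : ∃ w : H, ∃ a ∈ A w, w + σ • a = x := ⟨w, a, ha, hx⟩
  unfold resolventFun
  rw [dif_pos hex]
  obtain ⟨b, hb, hbx⟩ := hex.choose_spec
  set v := hex.choose
  have h0 := hA v w b a hb ha
  have h1 : v - w = σ • (a - b) := by
    rw [smul_sub, sub_eq_sub_iff_add_eq_add, hbx, add_comm, hx]
  have h2 : inner ℝ (v - w) (b - a) = -(σ * ‖a - b‖ ^ 2) := by
    rw [h1, ← neg_sub a b, inner_neg_right, inner_smul_left, real_inner_self_eq_norm_sq]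
    simp
  have h3 : ‖a - b‖ ^ 2 ≤ 0 := by
    rw [h2] at h0
    by_contra hc
    push Not at hc
    have := mul_pos hσ hc
    linarith
  have h4 : a - b = 0 := by
    rw [← norm_eq_zero]
    exact pow_eq_zero_iff (two_ne_zero) |>.mp (le_antisymm h3 (sq_nonneg _))
  rw [h4, smul_zero] at h1
  exact sub_eq_zero.mp h1

end Operators

/-! The explicit bounding functions. The natural-number subtractions below never truncate
when `c`, `D` and all values of `C` are positive. -/

/-- `ζ[c, C](k, n) = c (k + 1) C(n) - 1`. -/
def zeta (c : ℕ) (C : ℕ → ℕ) (k n : ℕ) : ℕ := c * (k + 1) * C n - 1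

/-- `σ̄[L, D](k, n) = L(n + ⌈ln(12 D² (k + 1))⌉) + 1`. -/
noncomputable def sigmaBar (L : ℕ → ℕ) (D k n : ℕ) : ℕ :=
  L (n + ⌈Real.log (12 * (D : ℝ) ^ 2 * ((k : ℝ) + 1))⌉₊) + 1

/-- `φ₂[D](k, n, f) = max {n, f^(4 D² (k + 1))(n)}`, an iterate of `f`. -/
def phi2 (D k n : ℕ) (f : ℕ → ℕ) : ℕ := max n (f^[4 * D ^ 2 * (k + 1)] n)

/-- `φ₁[D](k, n, f) = f(φ₂(k, n, f))`. -/
def phi1 (D k n : ℕ) (f : ℕ → ℕ) : ℕ := f (phi2 D k n f)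

/-- `f̃[k, f, L, D](n) = f(σ̄(k, n))`. -/
noncomputable def fTilde (k : ℕ) (f L : ℕ → ℕ) (D n : ℕ) : ℕ := f (sigmaBar L D k n)

/-- The function `f̃ + 2`. -/
noncomputable def fTildeAddTwo (k : ℕ) (f L : ℕ → ℕ) (D n : ℕ) : ℕ := fTilde k f L D n + 2

def r1 (c n : ℕ) : ℕ := 12 * c * (n + 1) ^ 2 - 1

def r2 (k D n : ℕ) : ℕ := max (2 * (n + 1)) (128 * D * (k + 1) ^ 2)

def r3 (k c : ℕ) (l : ℕ → ℕ) (D n : ℕ) : ℕ :=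
  l (max (96 * c * D ^ 2 * (n + 1) ^ 2 - 1)
    (max (256 * D ^ 2 * (k + 1) ^ 2 - 1) (16 * c * (r2 k D n) ^ 2 * D ^ 2)))

noncomputable def r4 (k c : ℕ) (f l : ℕ → ℕ) (D : ℕ) (L : ℕ → ℕ) (n : ℕ) : ℕ :=
  3 * (k + 1) *
    (fTilde k f L D (phi2 D (r1 c n) (r3 k c l D n) (fTildeAddTwo k f L D)) + 1)

/-- `Φ[k, c, f, ℓ, L, D](n) = φ₁(r₁(n), r₃(n), f̃ + 2)`. -/
noncomputable def Phi (k c : ℕ) (f l L : ℕ → ℕ) (D n : ℕ) : ℕ :=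
  phi1 D (r1 c n) (r3 k c l D n) (fTildeAddTwo k f L D)

noncomputable def Xi1 (k : ℕ) (f : ℕ → ℕ) (c : ℕ) (C l L : ℕ → ℕ) (D n : ℕ) : ℕ :=
  zeta c C (2 * (6 * D + 1) * max (r1 c n) (r4 k c f l D L n) - 1)
    (phi1 D (r1 c n) (r3 k c l D n) (fTildeAddTwo k f L D))

def xi (k : ℕ) (f : ℕ → ℕ) (c : ℕ) (C : ℕ → ℕ) (D : ℕ) (h : ℕ → ℕ) (n : ℕ) : ℕ :=
  zeta c C
    (max (16 * h (f n) * (k + 1) ^ 2 * (6 * D + 1)) (4 * c * (r2 k D n) ^ 2 * (6 * D + 1)))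
    (f n)

noncomputable def Xi2 (k : ℕ) (f : ℕ → ℕ) (c : ℕ) (C l L : ℕ → ℕ) (D : ℕ) (h : ℕ → ℕ)
    (n : ℕ) : ℕ :=
  xi k f c C D h (Phi k c f l L D n)

noncomputable def Xi (k : ℕ) (f : ℕ → ℕ) (c : ℕ) (C l L : ℕ → ℕ) (D : ℕ) (h : ℕ → ℕ)
    (n : ℕ) : ℕ :=
  max (Xi1 k f c C l L D n) (Xi2 k f c C l L D h n)

/-- `w_f(m) = max {f(24 D (m + 1)²), 24 D (m + 1)²}`. -/
def wFun (D : ℕ) (f : ℕ → ℕ) (m : ℕ) : ℕ :=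
  max (f (24 * D * (m + 1) ^ 2)) (24 * D * (m + 1) ^ 2)

/-- `β[D](k, f) = 24 D (w_f^(R)(0) + 1)²` with `R = 4 D⁴ (k + 1)²`. -/
def beta (D k : ℕ) (f : ℕ → ℕ) : ℕ :=
  24 * D * ((wFun D f)^[4 * D ^ 4 * (k + 1) ^ 2] 0 + 1) ^ 2

/-- The rate of metastability `μ(k, f)`, with parameters `c, C, h, ℓ, L, D`. -/
noncomputable def mu (c : ℕ) (C h l L : ℕ → ℕ) (D k : ℕ) (f : ℕ → ℕ) : ℕ :=
  let b : ℕ := beta D (32 * (k + 1) ^ 2 - 1) (Xi k f c C l L D h)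
  max (sigmaBar L D k (phi2 D (r1 c b) (r3 k c l D b) (fTildeAddTwo k f L D)))
    (Phi k c f l L D b)

end MPPA

namespace MPPA

open Filter Topology

/-! ### Minty's theorem via the Fitzpatrick function. -/

section Minty

variable {H : Type*} [NormedAddCommGroup H] [InnerProductSpace ℝ H]

/-! Classically, Halpern-type iterations converge to the projection of `u` onto the zero set, which
is also the limit of the curve t ↦ J_t u as t → ∞. Here a finite surrogate replaces that limit. The
squared distance ‖u - J_t u‖² increases with t and is at most D²/4, so by pigeonhole two consecutive
parameters T, S on a fast-growing scale give nearly equal points z = J_{T/c} u and x = J_{S/c} u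
(`exists_resolventFun_close`). Since S is large against Ξ(n₀), x is almost a zero: (c/S)(u - x) ∈ A
x is tiny. Since T is small against n₀, z satisfies an approximate variational inequality at almost
fixed points: if λ_n and d_n = ‖y_n - J_{c_n} y_n‖ are small, then ⟨u - x, y_{n+1} - x⟩ is small
(`inner_step_le`).

The sequence a_n = ‖y_n - x‖² obeys a_{n+1} ≤ (1 - λ_n) a_n + 2 λ_n ⟨u - x, y_{n+1} - x⟩ + e_n -
d_n²/c, where e_n measures how far x is from being a zero (`norm_step_sq_le`). `exists_le_forall_le`
then splits. If a is nonincreasing on a long range, pigeonhole finds a stretch with tiny total drop;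
d_n is small there and the recursion contracts (`le_of_small_drop`). If a increases somewhere, each
later term is bounded by the value just after the last increase, and at an increase the recursion
forces d_n, and hence that value, to be small (`le_of_le_succ`).

That the resolvents are defined everywhere is Minty's theorem (`resolventFun_spec`), obtained by
minimising a strongly convex function. -/

theorem IsMaximalMonotoneOp.mem_of_forall {A : H → Set H} (hA : IsMaximalMonotoneOp A) {x a : H}
    (h : ∀ y v, v ∈ A y → 0 ≤ inner ℝ (x - y) (a - v)) : a ∈ A x := by
  refine hA.2 (fun z => A z ∪ {b | z = x ∧ b = a}) ?_ (fun z => Set.subset_union_left) x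
    (Or.inr ⟨rfl, rfl⟩)
  rintro z z' b b' (hb | ⟨rfl, rfl⟩) (hb' | ⟨rfl, rfl⟩)
  · exact hA.1 _ _ _ _ hb hb'
  · have := h z b hb
    rwa [← neg_sub z, ← neg_sub b, inner_neg_neg] at this
  · exact h z' b' hb'
  · simp

theorem IsMaximalMonotoneOp.exists_mem {A : H → Set H} (hA : IsMaximalMonotoneOp A) :
    ∃ y v, v ∈ A y := by
  by_contra hne
  push Not at hne
  exact hne 0 0 (hA.mem_of_forall fun y v hv => absurd hv (hne y v))

/-- The epigraph of the Fitzpatrick function of `A`. -/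
def fitzpatrickEpi (A : H → Set H) : Set (H × H × ℝ) :=
  {e | ∀ y v, v ∈ A y → inner ℝ e.1 v + inner ℝ y e.2.1 - inner ℝ y v ≤ e.2.2}

theorem mem_fitzpatrickEpi_of_mem {A : H → Set H} (hA : IsMonotoneOp A) {y v : H}
    (hv : v ∈ A y) : (y, v, inner ℝ y v) ∈ fitzpatrickEpi A := by
  intro y' v' hv'
  have := hA y y' v v' hv hv'
  simp only [inner_sub_left, inner_sub_right] at this
  simp only
  linarith

/-- If this failed, (w, z) would be monotonically related to the whole graph, hence lie in it by
maximality; the epigraph inequality at (w, z) itself is then a contradiction. -/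
theorem IsMaximalMonotoneOp.inner_le {A : H → Set H} (hA : IsMaximalMonotoneOp A) {w z : H} {r : ℝ}
    (h : (w, z, r) ∈ fitzpatrickEpi A) : inner ℝ w z ≤ r := by
  by_contra! hlt
  have hz : z ∈ A w := hA.mem_of_forall fun y v hv => by
    have := h y v hv
    simp only [inner_sub_left, inner_sub_right] at this ⊢
    linarith
  have := h w z hz
  simp only at this
  linarith

theorem fitzpatrickEpi_combo {A : H → Set H} {w z w' z' : H} {r r' t : ℝ}
    (h : (w, z, r) ∈ fitzpatrickEpi A) (h' : (w', z', r') ∈ fitzpatrickEpi A)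
    (ht0 : 0 ≤ t) (ht1 : t ≤ 1) :
    ((1 - t) • w + t • w', (1 - t) • z + t • z', (1 - t) * r + t * r') ∈ fitzpatrickEpi A := by
  intro y v hv
  have h1 := mul_le_mul_of_nonneg_left (h y v hv) (sub_nonneg.2 ht1)
  have h2 := mul_le_mul_of_nonneg_left (h' y v hv) ht0
  simp only [inner_add_left, inner_add_right, real_inner_smul_left, real_inner_smul_right]
    at h1 h2 ⊢
  linarith

theorem norm_sq_combo (w w' : H) (t : ℝ) :
    ‖(1 - t) • w + t • w'‖ ^ 2 =
      (1 - t) * ‖w‖ ^ 2 + t * ‖w'‖ ^ 2 - t * (1 - t) * ‖w - w'‖ ^ 2 := by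
  rw [norm_add_sq_real, norm_sub_sq_real, norm_smul, norm_smul, mul_pow, mul_pow,
    Real.norm_eq_abs, Real.norm_eq_abs, sq_abs, sq_abs, real_inner_smul_left,
    real_inner_smul_right]
  ring

/-- The strongly convex function minimised in the proof of Minty's theorem. -/
def mintyValue (e : H × H × ℝ) : ℝ := 2 * e.2.2 + ‖e.1‖ ^ 2 + ‖e.2.1‖ ^ 2

theorem IsMaximalMonotoneOp.mintyValue_nonneg {A : H → Set H} (hA : IsMaximalMonotoneOp A)
    {e : H × H × ℝ} (he : e ∈ fitzpatrickEpi A) : 0 ≤ mintyValue e := by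
  have h1 := hA.inner_le (w := e.1) (z := e.2.1) (r := e.2.2) he
  have h2 := norm_add_sq_real e.1 e.2.1
  have h3 := sq_nonneg ‖e.1 + e.2.1‖
  unfold mintyValue
  linarith

theorem le_mintyValue_combo {A : H → Set H} {m : ℝ}
    (hm : ∀ e ∈ fitzpatrickEpi A, m ≤ mintyValue e) {e e' : H × H × ℝ}
    (he : e ∈ fitzpatrickEpi A) (he' : e' ∈ fitzpatrickEpi A) {t : ℝ} (ht0 : 0 ≤ t)
    (ht1 : t ≤ 1) :
    m + t * (1 - t) * (‖e.1 - e'.1‖ ^ 2 + ‖e.2.1 - e'.2.1‖ ^ 2) ≤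
      (1 - t) * mintyValue e + t * mintyValue e' := by
  have h := hm _ (fitzpatrickEpi_combo he he' ht0 ht1)
  unfold mintyValue at h ⊢
  simp only [norm_sq_combo] at h
  linarith

theorem IsMaximalMonotoneOp.exists_minimizer [CompleteSpace H] {A : H → Set H}
    (hA : IsMaximalMonotoneOp A) :
    ∃ e ∈ fitzpatrickEpi A, ∀ e' ∈ fitzpatrickEpi A, mintyValue e ≤ mintyValue e' := by
  obtain ⟨y₀, v₀, hv₀⟩ := hA.exists_mem
  set V : Set ℝ := mintyValue '' fitzpatrickEpi A
  have hVne : V.Nonempty := ⟨_, _, mem_fitzpatrickEpi_of_mem hA.1 hv₀, rfl⟩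
  have hVb : BddBelow V := ⟨0, by rintro _ ⟨e, he, rfl⟩; exact hA.mintyValue_nonneg he⟩
  set m := sInf V
  have hm : ∀ e ∈ fitzpatrickEpi A, m ≤ mintyValue e := fun e he => csInf_le hVb ⟨e, he, rfl⟩
  have hex : ∀ n : ℕ, ∃ e ∈ fitzpatrickEpi A, mintyValue e < m + 1 / ((n : ℝ) + 1) := by
    intro n
    obtain ⟨_, ⟨e, he, rfl⟩, hlt⟩ :=
      exists_lt_of_csInf_lt hVne (lt_add_of_pos_right m (Nat.one_div_pos_of_nat (n := n)))
    exact ⟨e, he, hlt⟩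
  choose e he hlt using hex
  have key : ∀ n k N : ℕ, N ≤ n → N ≤ k →
      ‖(e n).1 - (e k).1‖ ^ 2 + ‖(e n).2.1 - (e k).2.1‖ ^ 2 ≤ 4 * (1 / ((N : ℝ) + 1)) := by
    intro n k N hn hk
    -- Midpoints of near-minimisers cannot go below m, so strong convexity makes the sequence Cauchy
    -- in its first two coordinates.
    have h1 := le_mintyValue_combo hm (he n) (he k) (t := 1 / 2) (by norm_num) (by norm_num)
    have h2 : 1 / ((n : ℝ) + 1) ≤ 1 / ((N : ℝ) + 1) := Nat.one_div_le_one_div hn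
    have h3 : 1 / ((k : ℝ) + 1) ≤ 1 / ((N : ℝ) + 1) := Nat.one_div_le_one_div hk
    have h4 := hlt n
    have h5 := hlt k
    linarith
  have hlim : Tendsto (fun N : ℕ => √(4 * (1 / ((N : ℝ) + 1)))) atTop (𝓝 0) := by
    have := (tendsto_one_div_add_atTop_nhds_zero_nat (𝕜 := ℝ)).const_mul 4
    simpa using this.sqrt
  obtain ⟨w, hw⟩ := cauchySeq_tendsto_of_complete
    (cauchySeq_of_le_tendsto_0 (s := fun n => (e n).1) _ (fun n k N hn hk => by
      rw [dist_eq_norm]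
      exact Real.le_sqrt_of_sq_le
        (by linarith [key n k N hn hk, sq_nonneg ‖(e n).2.1 - (e k).2.1‖])) hlim)
  obtain ⟨z, hz⟩ := cauchySeq_tendsto_of_complete
    (cauchySeq_of_le_tendsto_0 (s := fun n => (e n).2.1) _ (fun n k N hn hk => by
      rw [dist_eq_norm]
      exact Real.le_sqrt_of_sq_le
        (by linarith [key n k N hn hk, sq_nonneg ‖(e n).1 - (e k).1‖])) hlim)
  have hval : Tendsto (fun n => mintyValue (e n)) atTop (𝓝 m) := by
    refine tendsto_of_tendsto_of_tendsto_of_le_of_le tendsto_const_nhds ?_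
      (fun n => hm _ (he n)) (fun n => (hlt n).le)
    simpa using (tendsto_one_div_add_atTop_nhds_zero_nat (𝕜 := ℝ)).const_add m
  have hr : Tendsto (fun n => (e n).2.2) atTop (𝓝 ((m - ‖w‖ ^ 2 - ‖z‖ ^ 2) / 2)) := by
    have := ((hval.sub (hw.norm.pow 2)).sub (hz.norm.pow 2)).div_const 2
    refine this.congr fun n => ?_
    unfold mintyValue
    ring
  refine ⟨(w, z, (m - ‖w‖ ^ 2 - ‖z‖ ^ 2) / 2), fun y v hv => ?_, fun e' he' => ?_⟩
  · refine le_of_tendsto_of_tendsto' ?_ hr (fun n => he n y v hv)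
    exact ((hw.inner tendsto_const_nhds).add (tendsto_const_nhds.inner hz)).sub tendsto_const_nhds
  · refine le_trans (le_of_eq ?_) (hm e' he')
    unfold mintyValue
    ring

theorem IsMaximalMonotoneOp.exists_neg_mem [CompleteSpace H] {A : H → Set H}
    (hA : IsMaximalMonotoneOp A) : ∃ w, -w ∈ A w := by
  obtain ⟨⟨w, z, r⟩, he, hmin⟩ := hA.exists_minimizer
  have hr := hA.inner_le he
  have key : ∀ y v, v ∈ A y → ‖w + z‖ ^ 2 ≤ inner ℝ (-z - y) (-w - v) := by
    intro y v hv
    have he' := mem_fitzpatrickEpi_of_mem hA.1 hv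
    set d := ‖w - y‖ ^ 2 + ‖z - v‖ ^ 2 with hd
    have hd0 : 0 ≤ d := by positivity
    -- First-order condition at the minimiser: move a fraction t towards a graph point, cancel the
    -- factor t, then let t → 0.
    have h1 : ∀ t : ℝ, 0 < t → t ≤ 1 →
        mintyValue (w, z, r) + (1 - t) * d ≤ mintyValue (y, v, inner ℝ y v) := by
      intro t ht ht1
      have := le_mintyValue_combo hmin he he' ht.le ht1
      simp only at this
      rw [← hd] at this
      have h2 : t * (mintyValue (w, z, r) + (1 - t) * d) ≤
          t * mintyValue (y, v, inner ℝ y v) := by linarith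
      exact le_of_mul_le_mul_left h2 ht
    have h2 : mintyValue (w, z, r) + d ≤ mintyValue (y, v, inner ℝ y v) := by
      refine le_of_forall_pos_le_add fun ε hε => ?_
      have hpos : 0 < min 1 (ε / (d + 1)) := by positivity
      have h3 := h1 _ hpos (min_le_left _ _)
      have h4 : min 1 (ε / (d + 1)) * d ≤ ε := by
        calc min 1 (ε / (d + 1)) * d ≤ ε / (d + 1) * (d + 1) :=
              mul_le_mul (min_le_right _ _) (by linarith) hd0 (by positivity)
          _ = ε := by field_simp
      linarith
    unfold mintyValue at h2
    simp only [hd, norm_sub_sq_real] at h2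
    rw [norm_add_sq_real]
    simp only [inner_sub_left, inner_sub_right, inner_neg_left, inner_neg_right]
    have h5 := real_inner_comm w y
    have h6 := real_inner_comm w z
    linarith
  have hmem : -w ∈ A (-z) :=
    hA.mem_of_forall fun y v hv => (sq_nonneg _).trans (key y v hv)
  -- Testing the new graph point (-z, -w) against itself forces w = -z.
  have h0 := key _ _ hmem
  simp only [sub_self, inner_zero_left] at h0
  have h1 : w + z = 0 := by
    rw [← norm_eq_zero]
    exact pow_eq_zero_iff two_ne_zero |>.mp (le_antisymm h0 (sq_nonneg _))
  have h2 : w = -z := eq_neg_of_add_eq_zero_left h1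
  exact ⟨w, by rwa [← h2] at hmem⟩

/-- **Minty's theorem**: the resolvents of a maximal monotone operator are everywhere defined. -/
theorem IsMaximalMonotoneOp.resolventFun_spec [CompleteSpace H] {A : H → Set H}
    (hA : IsMaximalMonotoneOp A) {σ : ℝ} (hσ : 0 < σ) (x : H) :
    ∃ a ∈ A (resolventFun A σ x), resolventFun A σ x + σ • a = x := by
  -- The operator σA - x inherits maximality, and -w ∈ (σA - x) w says exactly that w solves the
  -- resolvent equation.
  have hB : IsMaximalMonotoneOp fun w => {b | σ⁻¹ • (b + x) ∈ A w} := by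
    refine ⟨fun z z' b b' hb hb' => ?_, fun B hB hAB z b hb => ?_⟩
    · have := hA.1 _ _ _ _ hb hb'
      rw [← smul_sub, add_sub_add_right_eq_sub, real_inner_smul_right] at this
      exact nonneg_of_mul_nonneg_right this (inv_pos.2 hσ)
    · refine hA.mem_of_forall fun y v hv => ?_
      have hv' : σ • v - x ∈ B y := hAB y (by
        rwa [Set.mem_ofPred_eq, sub_add_cancel, inv_smul_smul₀ hσ.ne'])
      have h1 := hB _ _ _ _ hb hv'
      have h2 : σ⁻¹ • (b + x) - v = σ⁻¹ • (b - (σ • v - x)) := by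
        rw [sub_sub_eq_add_sub, smul_sub, inv_smul_smul₀ hσ.ne']
      rw [h2, real_inner_smul_right]
      exact mul_nonneg (inv_pos.2 hσ).le h1
  obtain ⟨w, hw⟩ := hB.exists_neg_mem
  have hwx : w + σ • σ⁻¹ • (-w + x) = x := by
    rw [smul_inv_smul₀ hσ.ne']
    abel
  rw [resolventFun_eq hA.1 hσ hw hwx]
  exact ⟨_, hw, hwx⟩

end Minty

/-! ### Inequalities for resolvents and for one step of the iteration. -/

section Hilbert

variable {H : Type*} [NormedAddCommGroup H] [InnerProductSpace ℝ H]

/-- The basic estimate for one step of the iteration, relative to a point `x` with `a ∈ A x`. -/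
theorem norm_step_sq_le {x a w b y u : H} {σ lam gam del M : ℝ}
    (hmono : 0 ≤ inner ℝ (w - x) (b - a))
    (hw : w + σ • b = y) (hσ : 0 ≤ σ) (hlam0 : 0 ≤ lam) (hlam1 : lam ≤ 1) (hgam : 0 ≤ gam)
    (hdel : 0 ≤ del) (hsum : lam + gam + del = 1) (hM : ‖w - x‖ ≤ M) :
    ‖lam • u + gam • y + del • w - x‖ ^ 2 ≤ (1 - lam) * ‖y - x‖ ^ 2 +
      2 * lam * inner ℝ (u - x) (lam • u + gam • y + del • w - x) + 2 * (σ * (‖a‖ * M)) -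
      del ^ 2 * ‖y - w‖ ^ 2 := by
  set Y := y - x with hY
  set W := w - x with hW
  have hYW : y - w = Y - W := by rw [hY, hW]; abel
  have hbW : σ • b = Y - W := by rw [← hYW, ← hw]; abel
  have hx : lam • u + gam • y + del • w - x = lam • (u - x) + (gam • Y + del • W) := by
    have : x = (lam + gam + del) • x := by rw [hsum, one_smul]
    nth_rewrite 1 [this]
    rw [hY, hW]
    simp only [smul_sub, add_smul]
    abel
  have h1 : ‖W‖ ^ 2 ≤ ‖Y‖ ^ 2 - ‖Y - W‖ ^ 2 + 2 * (σ * (‖a‖ * M)) := by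
    have h2 : 0 ≤ inner ℝ W (Y - W) - σ * inner ℝ W a := by
      rw [← hbW, real_inner_smul_right, ← mul_sub, ← inner_sub_right]
      exact mul_nonneg hσ hmono
    have h3 : -(σ * (‖a‖ * M)) ≤ σ * inner ℝ W a := by
      rw [neg_le]
      have h4 : -inner ℝ W a ≤ ‖a‖ * M := by
        have := (abs_le.1 (abs_real_inner_le_norm W a)).1
        have := mul_le_mul_of_nonneg_right hM (norm_nonneg a)
        linarith
      have := mul_le_mul_of_nonneg_left h4 hσ
      linarith
    have h5 : ‖Y‖ ^ 2 = ‖W‖ ^ 2 + 2 * inner ℝ W (Y - W) + ‖Y - W‖ ^ 2 := by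
      rw [← norm_add_sq_real, add_sub_cancel]
    linarith
  set v := gam • Y + del • W with hv
  have h2 : ‖v‖ ^ 2 = (gam + del) * (gam * ‖Y‖ ^ 2 + del * ‖W‖ ^ 2) - gam * del * ‖Y - W‖ ^ 2 := by
    rw [hv, norm_add_sq_real, norm_sub_sq_real Y W, norm_smul, norm_smul, mul_pow, mul_pow,
      Real.norm_eq_abs, Real.norm_eq_abs, sq_abs, sq_abs, real_inner_smul_left,
      real_inner_smul_right]
    ring
  have h3 : ‖lam • (u - x) + v‖ ^ 2 ≤
      ‖v‖ ^ 2 + 2 * lam * inner ℝ (u - x) (lam • (u - x) + v) := by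
    have h4 : v = (lam • (u - x) + v) - lam • (u - x) := by abel
    have h5 := norm_sub_sq_real (lam • (u - x) + v) (lam • (u - x))
    rw [← h4, real_inner_smul_right, real_inner_comm] at h5
    linarith [sq_nonneg ‖lam • (u - x)‖]
  rw [hx, hYW]
  have hM0 : 0 ≤ M := (norm_nonneg _).trans hM
  set E := 2 * (σ * (‖a‖ * M)) with hE
  have hE0 : 0 ≤ E := by positivity
  have hgd : gam + del = 1 - lam := by linarith
  have h4 : ‖v‖ ^ 2 ≤ (1 - lam) ^ 2 * ‖Y‖ ^ 2 + (1 - lam) * del * E - del ^ 2 * ‖Y - W‖ ^ 2 := by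
    have h5 := mul_le_mul_of_nonneg_left h1 (mul_nonneg (sub_nonneg.2 hlam1) hdel)
    -- With 1 - lam = gam + del the coefficient of ‖Y - W‖² is -(del² + 2 gam del); the second
    -- summand is dropped.
    have h6 : 0 ≤ 2 * (gam * del * ‖Y - W‖ ^ 2) := by positivity
    rw [h2, hgd]
    have h7 : gam = 1 - lam - del := by linarith
    subst h7
    nlinarith
  have h5 : (1 - lam) ^ 2 * ‖Y‖ ^ 2 ≤ (1 - lam) * ‖Y‖ ^ 2 := by
    gcongr
    nlinarith
  have h6 : (1 - lam) * del * E ≤ E := by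
    have : (1 - lam) * del ≤ 1 * 1 := by gcongr <;> linarith
    nlinarith
  linarith

/-- Comparison of the variational inequalities at two points. -/
theorem inner_sub_le_add {u x z q : H} {r M : ℝ} (hqz : inner ℝ (u - z) (q - z) ≤ r)
    (huz : ‖u - z‖ ≤ M) (hqx : ‖q - x‖ ≤ 3 * M) :
    inner ℝ (u - x) (q - x) ≤ r + 4 * M * ‖x - z‖ := by
  have h1 : inner ℝ (u - x) (q - x) =
      inner ℝ (u - z) (q - z) - inner ℝ (x - z) (q - x) - inner ℝ (u - z) (x - z) := by
    have e1 : q - z = (q - x) + (x - z) := by abel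
    have e2 : u - x = (u - z) - (x - z) := by abel
    rw [e1, e2, inner_add_right, inner_sub_left]
    ring
  have h2 := (abs_le.1 (abs_real_inner_le_norm (x - z) (q - x))).1
  have h3 := (abs_le.1 (abs_real_inner_le_norm (u - z) (x - z))).1
  have h4 := mul_le_mul_of_nonneg_left hqx (norm_nonneg (x - z))
  have h5 := mul_le_mul_of_nonneg_right huz (norm_nonneg (x - z))
  linarith

variable [CompleteSpace H]

theorem IsMaximalMonotoneOp.norm_resolventFun_sub_sq {A : H → Set H} (hA : IsMaximalMonotoneOp A)
    {p : H} (hp : p ∈ zeros A) {σ : ℝ} (hσ : 0 < σ) (x : H) :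
    ‖resolventFun A σ x - p‖ ^ 2 + ‖x - resolventFun A σ x‖ ^ 2 ≤ ‖x - p‖ ^ 2 := by
  obtain ⟨a, ha, hax⟩ := hA.resolventFun_spec hσ x
  set w := resolventFun A σ x
  have h1 := mul_nonneg hσ.le (hA.1 w p a 0 ha hp)
  rw [sub_zero, ← real_inner_smul_right, eq_sub_of_add_eq' hax] at h1
  have h2 := norm_add_sq_real (w - p) (x - w)
  rw [sub_add_sub_cancel'] at h2
  linarith

theorem IsMaximalMonotoneOp.norm_resolventFun_sub_le {A : H → Set H} (hA : IsMaximalMonotoneOp A)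
    {p : H} (hp : p ∈ zeros A) {σ : ℝ} (hσ : 0 < σ) (x : H) :
    ‖resolventFun A σ x - p‖ ≤ ‖x - p‖ :=
  sq_le_sq₀ (norm_nonneg _) (norm_nonneg _) |>.1
    (by linarith [hA.norm_resolventFun_sub_sq hp hσ x, sq_nonneg ‖x - resolventFun A σ x‖])

theorem IsMaximalMonotoneOp.norm_sub_resolventFun_le {A : H → Set H} (hA : IsMaximalMonotoneOp A)
    {p : H} (hp : p ∈ zeros A) {σ : ℝ} (hσ : 0 < σ) (x : H) :
    ‖x - resolventFun A σ x‖ ≤ ‖x - p‖ :=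
  sq_le_sq₀ (norm_nonneg _) (norm_nonneg _) |>.1
    (by linarith [hA.norm_resolventFun_sub_sq hp hσ x, sq_nonneg ‖resolventFun A σ x - p‖])

/-- Monotonicity makes the angle at J_t u between u and J_s u at least a right angle. It follows
that ‖u - J_t u‖² grows with t and that its increments control the displacement along the curve, so
boundedness yields close points. -/
theorem IsMaximalMonotoneOp.norm_resolventFun_sub_resolventFun_sq_le {A : H → Set H}
    (hA : IsMaximalMonotoneOp A) {s t : ℝ} (ht : 0 < t) (hts : t ≤ s) (u : H) :
    ‖resolventFun A s u - resolventFun A t u‖ ^ 2 ≤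
      ‖u - resolventFun A s u‖ ^ 2 - ‖u - resolventFun A t u‖ ^ 2 := by
  have hs : 0 < s := ht.trans_le hts
  obtain ⟨a, ha, hau⟩ := hA.resolventFun_spec hs u
  obtain ⟨b, hb, hbu⟩ := hA.resolventFun_spec ht u
  set x := resolventFun A s u
  set z := resolventFun A t u
  have h1 := hA.1 x z a b ha hb
  have hd : x - z = t • b - s • a := by
    rw [eq_sub_of_add_eq' hau, eq_sub_of_add_eq' hbu]
    abel
  have h2 : inner ℝ (x - z) (u - z) ≤ 0 := by
    rw [← eq_sub_of_add_eq' hbu, real_inner_smul_right]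
    refine mul_nonpos_of_nonneg_of_nonpos ht.le ?_
    have h3 : ‖x - z‖ ^ 2 = t * inner ℝ (x - z) b - s * inner ℝ (x - z) a := by
      rw [← real_inner_self_eq_norm_sq]
      nth_rewrite 2 [hd]
      rw [inner_sub_right, real_inner_smul_right, real_inner_smul_right]
    rw [inner_sub_right] at h1
    rcases hts.eq_or_lt with rfl | hlt
    · have h4 : ‖x - z‖ ^ 2 ≤ 0 := by nlinarith
      have h5 : x - z = 0 := by
        rw [← norm_eq_zero]
        exact pow_eq_zero_iff two_ne_zero |>.1 (le_antisymm h4 (sq_nonneg _))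
      simp [h5]
    · by_contra! hpos
      nlinarith [sq_nonneg ‖x - z‖, mul_pos (sub_pos.2 hlt) hpos, mul_nonneg hs.le h1]
  have h3 := norm_sub_sq_real (u - z) (x - z)
  rw [sub_sub_sub_cancel_right, real_inner_comm] at h3
  linarith

/-- Points with a small element of `A` attached are almost admissible in the variational
inequality for `J_t u`. -/
theorem IsMaximalMonotoneOp.inner_resolventFun_le {A : H → Set H} (hA : IsMaximalMonotoneOp A)
    {t : ℝ} (ht : 0 < t) (u : H) {q v : H} (hv : v ∈ A q) :
    inner ℝ (u - resolventFun A t u) (q - resolventFun A t u) ≤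
      t * (‖v‖ * ‖q - resolventFun A t u‖) := by
  obtain ⟨b, hb, hbu⟩ := hA.resolventFun_spec ht u
  set z := resolventFun A t u
  have h1 := hA.1 q z v b hv hb
  rw [← eq_sub_of_add_eq' hbu, real_inner_smul_left]
  refine mul_le_mul_of_nonneg_left ?_ ht.le
  have h2 := real_inner_le_norm (q - z) v
  rw [inner_sub_right] at h1
  rw [real_inner_comm, mul_comm ‖v‖]
  linarith

end Hilbert

/-! ### Real sequences: pigeonhole, the contracting recursion, divergence of ∑ λ. -/

section Sequences

theorem exists_sub_succ_le {b : ℕ → ℝ} {M : ℝ} (hb0 : ∀ i, 0 ≤ b i) (hbM : ∀ i, b i ≤ M)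
    {B : ℕ} (hB : 0 < B) : ∃ i < B, b i - b (i + 1) ≤ M / B := by
  by_contra! hcon
  have h1 : ∑ _i ∈ Finset.range B, M / B < ∑ i ∈ Finset.range B, (b i - b (i + 1)) :=
    Finset.sum_lt_sum_of_nonempty (Finset.nonempty_range_iff.2 hB.ne')
      fun i hi => hcon i (Finset.mem_range.1 hi)
  rw [Finset.sum_range_sub', Finset.sum_const, Finset.card_range, nsmul_eq_mul,
    mul_div_cancel₀ _ (Nat.cast_ne_zero.2 hB.ne')] at h1
  linarith [hb0 B, hbM 0]

theorem le_exp_mul_add {a lam : ℕ → ℝ} {E ε : ℝ} (hlam0 : ∀ j, 0 ≤ lam j) (hlam1 : ∀ j, lam j ≤ 1)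
    (hε : 0 ≤ ε) {m i : ℕ} (ham : 0 ≤ a m) (hE : 0 ≤ E) (hmi : m ≤ i)
    (hrec : ∀ j, m ≤ j → j < i → a (j + 1) ≤ (1 - lam j) * a j + lam j * E + ε) :
    a i ≤ Real.exp (-∑ j ∈ Finset.Ico m i, lam j) * a m + E + i * ε := by
  induction i, hmi using Nat.le_induction with
  | base =>
    simp only [Finset.Ico_self, Finset.sum_empty, neg_zero, Real.exp_zero, one_mul]
    have : 0 ≤ (m : ℝ) * ε := by positivity
    linarith
  | succ i hmi ih =>
    have h1 := ih fun j hj hji => hrec j hj (by omega)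
    have h2 := hrec i hmi (by omega)
    rw [Finset.sum_Ico_succ_top hmi, neg_add, Real.exp_add]
    set X := Real.exp (-∑ j ∈ Finset.Ico m i, lam j) * a m with hX
    have hX0 : 0 ≤ X := by positivity
    have h3 : 1 - lam i ≤ Real.exp (-lam i) := by linarith [Real.add_one_le_exp (-lam i)]
    have h4 := mul_le_mul_of_nonneg_left h1 (sub_nonneg.2 (hlam1 i))
    have h5 := mul_le_mul_of_nonneg_right h3 hX0
    have h6 : 0 ≤ lam i * (i * ε) := mul_nonneg (hlam0 i) (by positivity)
    push_cast
    have h7 : Real.exp (-∑ j ∈ Finset.Ico m i, lam j) * Real.exp (-lam i) * a m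
        = Real.exp (-lam i) * X := by rw [hX]; ring
    rw [h7]
    linarith

/-- The index `j` is the last place up to `i` where the sequence does not decrease; between `j + 1`
and `i` it only goes down. -/
theorem exists_le_succ_of_le_succ {a : ℕ → ℝ} {j₀ i : ℕ} (h₀ : a j₀ ≤ a (j₀ + 1)) (hi : j₀ ≤ i) :
    ∃ j, j₀ ≤ j ∧ j ≤ i ∧ a j ≤ a (j + 1) ∧ a i ≤ a (j + 1) := by
  induction i, hi using Nat.le_induction with
  | base => exact ⟨j₀, le_rfl, le_rfl, h₀, h₀⟩
  | succ i hi ih =>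
    obtain ⟨j, h1, h2, h3, h4⟩ := ih
    rcases le_total (a i) (a (i + 1)) with h | h
    · exact ⟨i, hi, by omega, h, le_rfl⟩
    · exact ⟨j, h1, by omega, h3, h.trans h4⟩

/-- Each λ is at most 1, so a sum of at least k needs L(k) ≥ k terms. -/
theorem add_lt_sigmaBar {lam : ℕ → ℝ} {L : ℕ → ℕ} (hlam1 : ∀ j, lam j ≤ 1)
    (hQ3 : ∀ k : ℕ, (k : ℝ) ≤ ∑ i ∈ Finset.Icc 1 (L k), lam i) (D k m : ℕ) :
    m < sigmaBar L D k m := by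
  unfold sigmaBar
  set q := ⌈Real.log (12 * (D : ℝ) ^ 2 * ((k : ℝ) + 1))⌉₊
  have h1 := hQ3 (m + q)
  have h2 : ∑ i ∈ Finset.Icc 1 (L (m + q)), lam i ≤ ∑ i ∈ Finset.Icc 1 (L (m + q)), (1 : ℝ) :=
    Finset.sum_le_sum fun i _ => hlam1 i
  simp only [Finset.sum_const, Nat.card_Icc, add_tsub_cancel_right, nsmul_eq_mul, mul_one] at h2
  have h3 : m + q ≤ L (m + q) := by exact_mod_cast h1.trans h2
  omega

theorem exp_neg_sum_le {lam : ℕ → ℝ} {L : ℕ → ℕ} (hlam0 : ∀ j, 0 ≤ lam j)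
    (hlam1 : ∀ j, lam j ≤ 1)
    (hQ3 : ∀ k : ℕ, (k : ℝ) ≤ ∑ i ∈ Finset.Icc 1 (L k), lam i) {D : ℕ} (hD : D ≠ 0)
    {k m i : ℕ} (hi : sigmaBar L D k m ≤ i) :
    Real.exp (-∑ j ∈ Finset.Ico m i, lam j) ≤ 1 / (12 * (D : ℝ) ^ 2 * ((k : ℝ) + 1)) := by
  unfold sigmaBar at hi
  set X := 12 * (D : ℝ) ^ 2 * ((k : ℝ) + 1)
  have hD' : (0 : ℝ) < D := by positivity
  have hX : 0 < X := by positivity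
  have h1 := hQ3 (m + ⌈Real.log X⌉₊)
  have h2 : ∑ j ∈ Finset.Icc 1 (L (m + ⌈Real.log X⌉₊)), lam j ≤
      ∑ j ∈ Finset.range m ∪ Finset.Ico m i, lam j := by
    refine Finset.sum_le_sum_of_subset_of_nonneg (fun j hj => ?_) fun j _ _ => hlam0 j
    simp only [Finset.mem_Icc, Finset.mem_union, Finset.mem_range, Finset.mem_Ico] at hj ⊢
    omega
  rw [Finset.sum_union (by
    rw [Finset.disjoint_left]; intro j hj hj'; simp at hj hj'; omega)] at h2
  -- The first `m` terms contribute at most `m`, which is why `sigmaBar` asks `L` for `m` plus the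
  -- logarithm.
  have h3 : ∑ j ∈ Finset.range m, lam j ≤ ∑ _j ∈ Finset.range m, (1 : ℝ) :=
    Finset.sum_le_sum fun j _ => hlam1 j
  simp only [Finset.sum_const, Finset.card_range, nsmul_eq_mul, mul_one] at h3
  push_cast at h1
  have h4 := Nat.le_ceil (Real.log X)
  calc Real.exp (-∑ j ∈ Finset.Ico m i, lam j) ≤ Real.exp (-Real.log X) :=
        Real.exp_le_exp.2 (by linarith)
    _ = 1 / X := by rw [Real.exp_neg, Real.exp_log hX, one_div]

end Sequences

/-! ### Monotonicity of the bounding functions. -/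

section Bounds

theorem r1_add_one {c : ℕ} (hc : c ≠ 0) (n : ℕ) : r1 c n + 1 = 12 * c * (n + 1) ^ 2 := by
  unfold r1
  have : 0 < 12 * c * (n + 1) ^ 2 := by positivity
  omega

theorem zeta_add_one {c : ℕ} (hc : c ≠ 0) {C : ℕ → ℕ} (hC : ∀ n, C n ≠ 0) (k n : ℕ) :
    zeta c C k n + 1 = c * (k + 1) * C n := by
  unfold zeta
  have := hC n
  have : 0 < c * (k + 1) * C n := by positivity
  omega

theorem sigmaBar_mono {L : ℕ → ℕ} (hL : Monotone L) (D k : ℕ) : Monotone (sigmaBar L D k) :=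
  fun _ _ h => Nat.add_le_add_right (hL (Nat.add_le_add_right h _)) 1

theorem fTildeAddTwo_mono {L f : ℕ → ℕ} (hL : Monotone L) (hf : Monotone f) (D k : ℕ) :
    Monotone (fTildeAddTwo k f L D) :=
  fun _ _ h => Nat.add_le_add_right (hf (sigmaBar_mono hL D k h)) 2

/-- The iterates of a monotone `g` from `n'` either all go up or all go down; the maximum with `n`
in `phi2` absorbs the second case. -/
theorem phi2_mono {g : ℕ → ℕ} (hg : Monotone g) (D : ℕ) {k k' n n' : ℕ} (hk : k ≤ k')
    (hn : n ≤ n') : phi2 D k n g ≤ phi2 D k' n' g := by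
  unfold phi2
  have hB : 4 * D ^ 2 * (k + 1) ≤ 4 * D ^ 2 * (k' + 1) := by gcongr
  refine max_le (le_max_of_le_left hn) ?_
  refine (hg.iterate _ hn).trans ?_
  rcases le_total n' (g n') with h | h
  · exact le_max_of_le_right (hg.monotone_iterate_of_le_map h hB)
  · exact le_max_of_le_left (hg.antitone_iterate_of_map_le h (Nat.zero_le _))

theorem r1_mono (c : ℕ) : Monotone (r1 c) := fun m n h => by
  unfold r1
  gcongr

theorem r3_mono {l : ℕ → ℕ} (hl : Monotone l) (k c D : ℕ) : Monotone (r3 k c l D) :=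
  fun m n h => by
    unfold r3 r2
    apply hl
    gcongr

theorem r3_ge {l : ℕ → ℕ} (hl : Monotone l) (k c D n : ℕ) :
    l (96 * c * D ^ 2 * (n + 1) ^ 2 - 1) ≤ r3 k c l D n ∧
    l (256 * D ^ 2 * (k + 1) ^ 2 - 1) ≤ r3 k c l D n ∧
    l (16 * c * (r2 k D n) ^ 2 * D ^ 2) ≤ r3 k c l D n :=
  ⟨hl (le_max_left _ _), hl ((le_max_left _ _).trans (le_max_right _ _)),
    hl ((le_max_right _ _).trans (le_max_right _ _))⟩

end Bounds

/-! ### Metastability for the abstract recursion. -/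

/-- The case where the sequence is nonincreasing on `[m, f(σ̄(k, m)) + 2]`. -/
theorem le_of_small_drop {lam a s e d : ℕ → ℝ} {f L : ℕ → ℕ} {c k D n₀ m : ℕ} {ρ : ℝ}
    (hD : D ≠ 0) (hc : c ≠ 0)
    (hlam0 : ∀ j, 0 ≤ lam j) (hlam1 : ∀ j, lam j ≤ 1)
    (hQ3 : ∀ k : ℕ, (k : ℝ) ≤ ∑ i ∈ Finset.Icc 1 (L k), lam i)
    (ha0 : ∀ j, 0 ≤ a j) (haD : ∀ j, a j ≤ 4 * (D : ℝ) ^ 2) (hsD : ∀ j, s j ≤ (D : ℝ) ^ 2)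
    (hrec : ∀ j, a (j + 1) ≤ (1 - lam j) * a j + 2 * lam j * s (j + 1) + e j - d j ^ 2 / c)
    (hsmall : ∀ j, m ≤ j → d j ^ 2 ≤ (1 / (2 * ((n₀ : ℝ) + 1))) ^ 2 →
      s (j + 1) ≤ 1 / (9 * ((k : ℝ) + 1)))
    (hlamm : ∀ j, m ≤ j → lam j ≤ 1 / (96 * (c : ℝ) * (D : ℝ) ^ 2 * ((n₀ : ℝ) + 1) ^ 2))
    (hdrop : ∀ j, m ≤ j → j ≤ f (sigmaBar L D k m) →
      a j - a (j + 1) ≤ 1 / (12 * (c : ℝ) * ((n₀ : ℝ) + 1) ^ 2))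
    (hρ0 : 0 ≤ ρ) (he1 : ∀ j, m ≤ j → j ≤ f (sigmaBar L D k m) → e j ≤ ρ)
    (hρ1 : ρ ≤ 1 / (44 * (c : ℝ) * ((n₀ : ℝ) + 1) ^ 2))
    (hρ2 : f (sigmaBar L D k m) * ρ ≤ 1 / (12 * ((k : ℝ) + 1)))
    {i : ℕ} (hi1 : sigmaBar L D k m ≤ i) (hi2 : i ≤ f (sigmaBar L D k m)) :
    a i ≤ 1 / ((k : ℝ) + 1) := by
  have hD' : (0 : ℝ) < D := by positivity
  have hc' : (0 : ℝ) < c := by positivity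
  have hmi : m ≤ i := (add_lt_sigmaBar hlam1 hQ3 D k m).le.trans hi1
  set κ : ℝ := 1 / ((k : ℝ) + 1) with hκ
  have hκ0 : 0 < κ := by positivity
  have hs9 : ∀ j, m ≤ j → j < i → s (j + 1) ≤ κ / 9 := by
    intro j hj hji
    refine (hsmall j hj ?_).trans (le_of_eq (by rw [hκ]; field_simp))
    have h1 := hrec j
    have h2 := hdrop j hj (by omega)
    have h3 := he1 j hj (by omega)
    have h4 : lam j * s (j + 1) ≤ 1 / (96 * (c : ℝ) * ((n₀ : ℝ) + 1) ^ 2) := by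
      calc lam j * s (j + 1) ≤ lam j * (D : ℝ) ^ 2 :=
            mul_le_mul_of_nonneg_left (hsD _) (hlam0 j)
        _ ≤ 1 / (96 * (c : ℝ) * (D : ℝ) ^ 2 * ((n₀ : ℝ) + 1) ^ 2) * (D : ℝ) ^ 2 :=
            mul_le_mul_of_nonneg_right (hlamm j hj) (by positivity)
        _ = _ := by field_simp
    have h5 : 0 ≤ lam j * a j := mul_nonneg (hlam0 j) (ha0 j)
    set τ : ℝ := 1 / ((c : ℝ) * ((n₀ : ℝ) + 1) ^ 2) with hτ
    have e1 : 1 / (12 * (c : ℝ) * ((n₀ : ℝ) + 1) ^ 2) = τ / 12 := by rw [hτ]; field_simp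
    have e2 : 1 / (44 * (c : ℝ) * ((n₀ : ℝ) + 1) ^ 2) = τ / 44 := by rw [hτ]; field_simp
    have e3 : 1 / (96 * (c : ℝ) * ((n₀ : ℝ) + 1) ^ 2) = τ / 96 := by rw [hτ]; field_simp
    rw [e1] at h2
    rw [e2] at hρ1
    rw [e3] at h4
    have hτ0 : 0 < τ := by positivity
    -- The recursion bounds d²/c by drop + 2λs + e, at most τ/12 + τ/48 + τ/44.
    have h6 : d j ^ 2 / c ≤ τ / 4 := by linarith
    rw [div_le_iff₀ hc'] at h6
    refine h6.trans (le_of_eq ?_)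
    rw [hτ]
    field_simp
    norm_num
  have hmain := le_exp_mul_add (a := a) (E := 2 * κ / 9) hlam0 hlam1 hρ0 (ha0 m) (by positivity)
    hmi (fun j hj hji => by
      have h1 := hrec j
      have h2 := mul_le_mul_of_nonneg_left (hs9 j hj hji) (hlam0 j)
      have h3 := he1 j hj (by omega)
      have h4 : 0 ≤ d j ^ 2 / c := by positivity
      linarith)
  have h1 : Real.exp (-∑ j ∈ Finset.Ico m i, lam j) * a m ≤ κ / 3 := by
    calc _ ≤ 1 / (12 * (D : ℝ) ^ 2 * ((k : ℝ) + 1)) * (4 * (D : ℝ) ^ 2) :=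
          mul_le_mul (exp_neg_sum_le hlam0 hlam1 hQ3 hD hi1) (haD m) (ha0 m) (by positivity)
      _ = κ / 3 := by rw [hκ]; field_simp; norm_num
  have h2 : (i : ℝ) * ρ ≤ κ / 12 := by
    calc (i : ℝ) * ρ ≤ f (sigmaBar L D k m) * ρ :=
          mul_le_mul_of_nonneg_right (by exact_mod_cast hi2) hρ0
      _ ≤ _ := hρ2
      _ = κ / 12 := by rw [hκ]; field_simp
  -- The total is κ/3 + 2κ/9 + κ/12 = 23κ/36.
  linarith

/-- The case where the sequence increases at an index `j`. -/
theorem le_of_le_succ {lam a s e d : ℕ → ℝ} {c k n₀ j : ℕ} {D η r : ℝ} (hD : 0 < D) (hc : c ≠ 0)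
    (hlam0 : 0 < lam j) (hlam1 : lam j ≤ 1) (ha0 : 0 ≤ a j) (hsD : s (j + 1) ≤ D ^ 2)
    (hrec : a (j + 1) ≤ (1 - lam j) * a j + 2 * lam j * s (j + 1) + e j - d j ^ 2 / c)
    (hsmall : d j ^ 2 ≤ (1 / (2 * ((n₀ : ℝ) + 1))) ^ 2 → s (j + 1) ≤ 1 / (9 * ((k : ℝ) + 1)))
    (hr : (n₀ : ℝ) + 1 ≤ r)
    (hlamm : lam j ≤ 1 / (16 * (c : ℝ) * r ^ 2 * D ^ 2))
    (he1 : e j ≤ 1 / (8 * (c : ℝ) * r ^ 2)) (hη : η ≤ lam j)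
    (he2 : e j ≤ η / (32 * ((k : ℝ) + 1)))
    (hinc : a j ≤ a (j + 1)) : a (j + 1) ≤ 1 / ((k : ℝ) + 1) := by
  have hc' : (0 : ℝ) < c := by positivity
  have hr0 : 0 < r := lt_of_lt_of_le (by positivity) hr
  set κ : ℝ := 1 / ((k : ℝ) + 1) with hκ
  have hκ0 : 0 < κ := by positivity
  have hs9 : s (j + 1) ≤ κ / 9 := by
    refine (hsmall ?_).trans (le_of_eq (by rw [hκ]; field_simp))
    have h4 : lam j * s (j + 1) ≤ 1 / (16 * (c : ℝ) * r ^ 2) := by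
      calc lam j * s (j + 1) ≤ lam j * D ^ 2 := mul_le_mul_of_nonneg_left hsD hlam0.le
        _ ≤ 1 / (16 * (c : ℝ) * r ^ 2 * D ^ 2) * D ^ 2 :=
            mul_le_mul_of_nonneg_right hlamm (by positivity)
        _ = _ := by field_simp
    have h5 : 0 ≤ lam j * a j := mul_nonneg hlam0.le ha0
    set τ : ℝ := 1 / ((c : ℝ) * r ^ 2) with hτ
    have e1 : 1 / (8 * (c : ℝ) * r ^ 2) = τ / 8 := by rw [hτ]; field_simp
    have e3 : 1 / (16 * (c : ℝ) * r ^ 2) = τ / 16 := by rw [hτ]; field_simp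
    rw [e1] at he1
    rw [e3] at h4
    have h6 : d j ^ 2 / c ≤ τ / 4 := by linarith
    rw [div_le_iff₀ hc'] at h6
    have h7 : (1 / (2 * r)) ^ 2 ≤ (1 / (2 * ((n₀ : ℝ) + 1))) ^ 2 := by gcongr
    refine (h6.trans (le_of_eq ?_)).trans h7
    rw [hτ]
    field_simp
    norm_num
  have h1 : e j ≤ lam j * (κ / 32) := by
    calc e j ≤ η / (32 * ((k : ℝ) + 1)) := he2
      _ ≤ lam j / (32 * ((k : ℝ) + 1)) := by gcongr
      _ = _ := by rw [hκ]; field_simp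
  have h2 := mul_le_mul_of_nonneg_left hs9 hlam0.le
  have h3 : 0 ≤ d j ^ 2 / c := by positivity
  have h4 := mul_le_mul_of_nonneg_left hinc (sub_nonneg.2 hlam1)
  -- As a_j ≤ a_{j+1}, the recursion leaves λ a_{j+1} ≤ 2λs + e. Dividing by λ requires e small
  -- relative to λ, which is where the lower bound `η` enters.
  have h5 : lam j * a (j + 1) ≤ lam j * κ := by
    have := mul_pos hlam0 hκ0
    linarith
  exact le_of_mul_le_mul_left h5 hlam0

/-- The factor `c * C n` built into `zeta` cancels the growth of the step sizes up to index `n`. -/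
theorem mul_le_of_zeta_le {c K n X Cj : ℕ} {C : ℕ → ℕ} {D e : ℝ} (hc : c ≠ 0)
    (hC : ∀ n, C n ≠ 0) (hD : 0 ≤ D) (he0 : 0 ≤ e) (hX : zeta c C K n ≤ X)
    (hCj : Cj ≤ C n) (he : e * ((X : ℝ) + 1) ≤ 3 * D * c * Cj) :
    e * ((K : ℝ) + 1) ≤ 3 * D := by
  have h1 : c * (K + 1) * C n ≤ X + 1 := by rw [← zeta_add_one hc hC]; omega
  have h2 : (c : ℝ) * ((K : ℝ) + 1) * C n ≤ (X : ℝ) + 1 := by exact_mod_cast h1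
  have hCn : (0 : ℝ) < C n := by have := hC n; positivity
  have hc' : (0 : ℝ) < c := by positivity
  have h3 : (Cj : ℝ) ≤ C n := by exact_mod_cast hCj
  have h4 : e * ((K : ℝ) + 1) * (c * C n) ≤ 3 * D * (c * C n) := by
    calc e * ((K : ℝ) + 1) * (c * C n) = e * (c * ((K : ℝ) + 1) * C n) := by ring
      _ ≤ e * ((X : ℝ) + 1) := mul_le_mul_of_nonneg_left h2 he0
      _ ≤ 3 * D * c * Cj := he
      _ ≤ 3 * D * c * C n := by gcongr
      _ = _ := by ring
  exact le_of_mul_le_mul_right h4 (by positivity)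

/-- The metastability statement for `‖y_i - x‖²`, on the level of real sequences. -/
theorem exists_le_forall_le {lam a s e d : ℕ → ℝ} {C h l L f : ℕ → ℕ} {c k D n₀ : ℕ}
    (hD : D ≠ 0) (hc : c ≠ 0) (hh : Monotone h) (hl : Monotone l) (hL : Monotone L)
    (hC : Monotone C) (hf : Monotone f) (hC0 : ∀ n, C n ≠ 0) (hhpos : ∀ n, h n ≠ 0)
    (hlam0 : ∀ j, 0 < lam j) (hlam1 : ∀ j, lam j ≤ 1)
    (hQ1 : ∀ n, 1 / (h n : ℝ) ≤ lam n)
    (hQ2 : ∀ k n, l k ≤ n → lam n ≤ 1 / ((k : ℝ) + 1))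
    (hQ3 : ∀ k : ℕ, (k : ℝ) ≤ ∑ i ∈ Finset.Icc 1 (L k), lam i)
    (ha0 : ∀ j, 0 ≤ a j) (haD : ∀ j, a j ≤ 4 * (D : ℝ) ^ 2) (hsD : ∀ j, s j ≤ (D : ℝ) ^ 2)
    (hrec : ∀ j, a (j + 1) ≤ (1 - lam j) * a j + 2 * lam j * s (j + 1) + e j - d j ^ 2 / c)
    (hsmall : ∀ j, lam j ≤ 1 / (256 * (D : ℝ) ^ 2 * ((k : ℝ) + 1) ^ 2) →
      d j ^ 2 ≤ (1 / (2 * ((n₀ : ℝ) + 1))) ^ 2 → s (j + 1) ≤ 1 / (9 * ((k : ℝ) + 1)))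
    (he0 : ∀ j, 0 ≤ e j)
    (he : ∀ j, e j * ((Xi k f c C l L D h n₀ : ℝ) + 1) ≤ 3 * D * c * C j) :
    ∃ n ≤ max (sigmaBar L D k (phi2 D (r1 c n₀) (r3 k c l D n₀) (fTildeAddTwo k f L D)))
        (Phi k c f l L D n₀), ∀ i ∈ Set.Icc n (f n), a i ≤ 1 / ((k : ℝ) + 1) := by
  have hD' : (0 : ℝ) < D := by positivity
  have hc' : (0 : ℝ) < c := by positivity
  set σ := sigmaBar L D k with hσ
  set g := fTildeAddTwo k f L D with hg
  have hgm : Monotone g := fTildeAddTwo_mono hL hf D k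
  have hg_eq : ∀ m, g m = f (σ m) + 2 := fun m => rfl
  have hσm : Monotone σ := sigmaBar_mono hL D k
  have hσlt : ∀ m, m < σ m := add_lt_sigmaBar hlam1 hQ3 D k
  set N := r3 k c l D n₀ with hN
  set B := 4 * D ^ 2 * (r1 c n₀ + 1) with hB
  have hB0 : 0 < B := by positivity
  have hphi : phi2 D (r1 c n₀) N g = max N (g^[B] N) := rfl
  -- If some interval [σ, f(σ)] is empty, metastability holds vacuously there; otherwise the
  -- iterates of `g` strictly increase.
  by_cases htriv : ∃ i ≤ B, f (σ (g^[i] N)) < σ (g^[i] N)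
  · obtain ⟨i, hi, hlt⟩ := htriv
    refine ⟨σ (g^[i] N), le_max_of_le_left (hσm ?_), fun j hj => ?_⟩
    · rw [hphi]
      rcases le_total N (g N) with hN' | hN'
      · exact le_max_of_le_right (hgm.monotone_iterate_of_le_map hN' hi)
      · exact le_max_of_le_left (hgm.antitone_iterate_of_map_le hN' (Nat.zero_le _))
    · exact absurd (hj.1.trans hj.2) (not_le.2 hlt)
  push Not at htriv
  have hstep : ∀ i ≤ B, g^[i] N + 1 ≤ g^[i + 1] N := by
    intro i hi
    rw [Function.iterate_succ_apply', hg_eq]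
    have := htriv i hi
    have := hσlt (g^[i] N)
    omega
  have hgrow : ∀ i ≤ B + 1, N + i ≤ g^[i] N := by
    intro i
    induction i with
    | zero => intro _; simp
    | succ i ih =>
      intro hi
      have := ih (by omega)
      have := hstep i (by omega)
      omega
  have hNg : N ≤ g N := by
    have := hgrow 1 (by omega)
    simp only [Function.iterate_one] at this
    omega
  have hitm : Monotone fun i => g^[i] N := hgm.monotone_iterate_of_le_map hNg
  have hphi' : phi2 D (r1 c n₀) N g = g^[B] N := by
    rw [hphi]
    exact max_eq_right (hitm (Nat.zero_le B))
  have hPhi : Phi k c f l L D n₀ = g^[B + 1] N := by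
    unfold Phi phi1
    rw [← hg, ← hN, hphi', Function.iterate_succ_apply']
  set P := Phi k c f l L D n₀ with hP
  have hr1 := r1_add_one hc n₀
  have hr1B : ((r1 c n₀ : ℕ) : ℝ) + 1 = 12 * c * ((n₀ : ℝ) + 1) ^ 2 := by exact_mod_cast hr1
  obtain ⟨hl1, hl2, hl3⟩ := r3_ge hl k c D n₀
  have hlam_a : ∀ j, N ≤ j →
      lam j ≤ 1 / (96 * (c : ℝ) * (D : ℝ) ^ 2 * ((n₀ : ℝ) + 1) ^ 2) := by
    intro j hj
    refine (hQ2 _ j (hl1.trans hj)).trans (le_of_eq ?_)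
    rw [Nat.cast_sub (Nat.one_le_iff_ne_zero.2 (by positivity))]
    push_cast
    rw [sub_add_cancel]
  have hlam_b : ∀ j, N ≤ j → lam j ≤ 1 / (256 * (D : ℝ) ^ 2 * ((k : ℝ) + 1) ^ 2) := by
    intro j hj
    refine (hQ2 _ j (hl2.trans hj)).trans (le_of_eq ?_)
    rw [Nat.cast_sub (Nat.one_le_iff_ne_zero.2 (by positivity))]
    push_cast
    rw [sub_add_cancel]
  have hr2 : 0 < r2 k D n₀ := by unfold r2; positivity
  have hlam_c : ∀ j, N ≤ j →
      lam j ≤ 1 / (16 * (c : ℝ) * (r2 k D n₀ : ℝ) ^ 2 * (D : ℝ) ^ 2) := by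
    intro j hj
    refine (hQ2 _ j (hl3.trans hj)).trans ?_
    push_cast
    exact one_div_le_one_div_of_le (by positivity) (by linarith)
  by_cases hmono : ∀ j, N ≤ j → j < P → a (j + 1) ≤ a j
  · obtain ⟨i, hiB, hi⟩ := exists_sub_succ_le (b := fun i => a (g^[i] N)) (fun i => ha0 _)
      (fun i => haD _) hB0
    rw [Function.iterate_succ_apply'] at hi
    set m := g^[i] N with hm
    have hNm : N ≤ m := hitm (Nat.zero_le i)
    have hmphi : m ≤ phi2 D (r1 c n₀) N g := hphi' ▸ hitm hiB.le
    have hgP : g m ≤ P := by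
      rw [hPhi, hm, ← Function.iterate_succ_apply' g]
      exact hitm (by omega)
    have hfP : f (σ m) + 2 ≤ P := hgP
    have hanti : ∀ i j, N ≤ i → i ≤ j → j ≤ P → a j ≤ a i := by
      intro i j hi hij
      induction j, hij using Nat.le_induction with
      | base => intro _; exact le_rfl
      | succ j hj ih => exact fun hjP => (hmono j (hi.trans hj) (by omega)).trans (ih (by omega))
    have hdrop : ∀ j, m ≤ j → j ≤ f (σ m) →
        a j - a (j + 1) ≤ 1 / (12 * (c : ℝ) * ((n₀ : ℝ) + 1) ^ 2) := by
      intro j hj hjf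
      -- On a nonincreasing stretch each single drop is at most the drop across [m, g m], which the
      -- pigeonhole made at most 4D²/B.
      have h1 := hanti m j hNm hj (by omega)
      have h2 := hanti (j + 1) (g m) (by omega) (by rw [hg_eq]; omega) hgP
      have h3 : 4 * (D : ℝ) ^ 2 / (B : ℝ) = 1 / (12 * (c : ℝ) * ((n₀ : ℝ) + 1) ^ 2) := by
        rw [hB]
        push_cast
        rw [hr1B]
        field_simp
      rw [h3] at hi
      linarith
    set M := max (r1 c n₀) (r4 k c f l D L n₀) with hM
    have hcn : 1 ≤ c * (n₀ + 1) ^ 2 := Nat.one_le_iff_ne_zero.2 (by positivity)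
    -- The -1 in `r1` lowers 12 to 11, whence the constant 44 = 4 · 11 required of ρ = 1/(4M).
    have hM1 : 11 * (c * (n₀ + 1) ^ 2) ≤ M := le_max_of_le_left (by
      have : 12 * c * (n₀ + 1) ^ 2 = 12 * (c * (n₀ + 1) ^ 2) := by ring
      omega)
    have hM2 : 3 * (k + 1) * (f (σ m) + 1) ≤ M := le_max_of_le_right (by
      unfold r4 fTilde
      gcongr
      exact hf (hσm hmphi))
    have hM1' : 11 * ((c : ℝ) * ((n₀ : ℝ) + 1) ^ 2) ≤ M := by exact_mod_cast hM1
    have hM2' : 3 * ((k : ℝ) + 1) * ((f (σ m) : ℝ) + 1) ≤ M := by exact_mod_cast hM2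
    have hM0 : (0 : ℝ) < M := lt_of_lt_of_le (by positivity) hM1'
    have hM0' : M ≠ 0 := (Nat.cast_pos.1 hM0).ne'
    have hXi : zeta c C (2 * (6 * D + 1) * M - 1) P ≤ Xi k f c C l L D h n₀ := le_max_left _ _
    refine ⟨σ m, le_max_of_le_left (hσm hmphi), fun i hi => ?_⟩
    refine le_of_small_drop (n₀ := n₀) (ρ := 1 / (4 * (M : ℝ))) hD hc (fun j => (hlam0 j).le)
      hlam1 hQ3 ha0 haD hsD hrec
      (fun j hj => hsmall j (hlam_b j (hNm.trans hj))) (fun j hj => hlam_a j (hNm.trans hj))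
      hdrop (by positivity) ?_ ?_ ?_ hi.1 hi.2
    · intro j _ hj
      have hjP : j ≤ P := hj.trans (by omega : f (σ m) ≤ P)
      have h1 := mul_le_of_zeta_le hc hC0 hD'.le (he0 j) hXi (hC hjP) (he j)
      rw [Nat.cast_sub (Nat.one_le_iff_ne_zero.2 (by positivity))] at h1
      push_cast at h1
      rw [sub_add_cancel] at h1
      rw [le_div_iff₀ (by positivity)]
      have h2 : (6 * (D : ℝ)) * (e j * (4 * M)) ≤ 6 * D * 1 := by
        have := mul_nonneg (he0 j) hM0.le
        linarith
      exact le_of_mul_le_mul_left h2 (by positivity)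
    · exact one_div_le_one_div_of_le (by positivity) (by linarith)
    · rw [mul_one_div, div_le_div_iff₀ (by positivity) (by positivity)]
      linarith [show 0 < ((k : ℝ) + 1) by positivity]
  · push Not at hmono
    obtain ⟨j₀, hNj, hjP, hlt⟩ := hmono
    refine ⟨P, le_max_right _ _, fun i hi => ?_⟩
    obtain ⟨j, h1, h2, h3, h4⟩ := exists_le_succ_of_le_succ hlt.le (hjP.le.trans hi.1)
    have hNj' : N ≤ j := hNj.trans h1
    have hjf : j ≤ f P := h2.trans hi.2
    -- `Xi2` evaluates `xi`, and with it `r2`, at `P`, while the estimate needs `r2` at `n₀`.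
    have hP0 : n₀ ≤ P := by
      have h5 := hgrow (B + 1) le_rfl
      have h6 : r1 c n₀ + 1 ≤ B := Nat.le_mul_of_pos_left _ (by positivity)
      have h7 : n₀ + 1 ≤ 12 * c * (n₀ + 1) ^ 2 := by
        calc n₀ + 1 ≤ (n₀ + 1) ^ 2 := Nat.le_self_pow two_ne_zero _
          _ ≤ _ := Nat.le_mul_of_pos_left _ (by positivity)
      omega
    refine h4.trans ?_
    have hXi : zeta c C (max (16 * h (f P) * (k + 1) ^ 2 * (6 * D + 1))
        (4 * c * (r2 k D P) ^ 2 * (6 * D + 1))) (f P) ≤ Xi k f c C l L D h n₀ := le_max_right _ _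
    have h5 := mul_le_of_zeta_le hc hC0 hD'.le (he0 j) hXi (hC hjf) (he j)
    have hhP : (0 : ℝ) < h (f P) := by have := hhpos (f P); positivity
    have hk : (1 : ℝ) ≤ (k : ℝ) + 1 := by linarith [Nat.cast_nonneg (α := ℝ) k]
    have hr2P : r2 k D n₀ ≤ r2 k D P := by unfold r2; gcongr
    have hr2P' : (r2 k D n₀ : ℝ) ≤ r2 k D P := by exact_mod_cast hr2P
    have hr2' : (0 : ℝ) < r2 k D n₀ := by exact_mod_cast hr2
    refine le_of_le_succ (n₀ := n₀) (η := 1 / (h (f P) : ℝ)) (r := r2 k D n₀) hD' hc (hlam0 j)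
      (hlam1 j) (ha0 j) (hsD _) (hrec j) (hsmall j (hlam_b j hNj')) ?_ (hlam_c j hNj') ?_ ?_ ?_ h3
    · have : n₀ + 1 ≤ r2 k D n₀ := le_max_of_le_left (by omega)
      exact_mod_cast this
    · rw [le_div_iff₀ (by positivity)]
      have h6 : 4 * (c : ℝ) * (r2 k D P : ℝ) ^ 2 * (6 * D + 1) ≤
          ((max (16 * h (f P) * (k + 1) ^ 2 * (6 * D + 1))
            (4 * c * (r2 k D P) ^ 2 * (6 * D + 1)) : ℕ) : ℝ) := by
        exact_mod_cast le_max_right _ _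
      have h7 : 4 * (c : ℝ) * (r2 k D n₀ : ℝ) ^ 2 * (6 * D) ≤
          4 * (c : ℝ) * (r2 k D P : ℝ) ^ 2 * (6 * D + 1) := by gcongr; linarith
      have h8 := mul_le_mul_of_nonneg_left (h7.trans h6) (he0 j)
      have h9 : (3 * (D : ℝ)) * (e j * (8 * c * (r2 k D n₀ : ℝ) ^ 2)) ≤ 3 * D * 1 := by
        linarith [he0 j]
      exact le_of_mul_le_mul_left h9 (by positivity)
    · exact (one_div_le_one_div_of_le (by have := hhpos j; positivity)
        (by exact_mod_cast hh hjf)).trans (hQ1 j)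
    · rw [div_div, le_div_iff₀ (by positivity)]
      have h6 : 16 * (h (f P) : ℝ) * ((k : ℝ) + 1) ^ 2 * (6 * D + 1) ≤
          ((max (16 * h (f P) * (k + 1) ^ 2 * (6 * D + 1))
            (4 * c * (r2 k D P) ^ 2 * (6 * D + 1)) : ℕ) : ℝ) := by
        exact_mod_cast le_max_left _ _
      have h7 : 16 * (h (f P) : ℝ) * ((k : ℝ) + 1) * (6 * D) ≤
          16 * (h (f P) : ℝ) * ((k : ℝ) + 1) ^ 2 * (6 * D + 1) := by
        gcongr
        · exact le_self_pow₀ hk two_ne_zero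
        · linarith
      have h8 := mul_le_mul_of_nonneg_left (h7.trans h6) (he0 j)
      have h9 : (3 * (D : ℝ)) * (e j * (h (f P) * (32 * ((k : ℝ) + 1)))) ≤ 3 * D * 1 := by
        linarith [he0 j]
      exact le_of_mul_le_mul_left h9 (by positivity)

/-! ### Choice of the point x and assembly. -/

section Main

theorem wFun_iterate_mono (D : ℕ) (X : ℕ → ℕ) : Monotone fun i => (wFun D X)^[i] 0 := by
  rcases Nat.eq_zero_or_pos D with rfl | hD
  · have h0 : ∀ m, wFun 0 X m = X 0 := fun m => by simp [wFun]
    refine monotone_nat_of_le_succ fun i => ?_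
    rw [Function.iterate_succ_apply', h0]
    cases i with
    | zero => simp
    | succ i => rw [Function.iterate_succ_apply', h0]
  · refine monotone_nat_of_le_succ fun i => ?_
    rw [Function.iterate_succ_apply']
    set m := (wFun D X)^[i] 0
    calc m ≤ (m + 1) ^ 2 := (Nat.le_succ m).trans (Nat.le_self_pow two_ne_zero _)
      _ ≤ 24 * D * (m + 1) ^ 2 := Nat.le_mul_of_pos_left _ (by positivity)
      _ ≤ _ := le_max_right _ _

variable {H : Type*} [NormedAddCommGroup H] [InnerProductSpace ℝ H] [CompleteSpace H]

/-- Two consecutive points of the resolvent curve through `u` that are close to each other. -/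
theorem IsMaximalMonotoneOp.exists_resolventFun_close {A : H → Set H} (hA : IsMaximalMonotoneOp A)
    {p u : H} (hp : p ∈ zeros A) {c D k : ℕ} (hc : c ≠ 0) (hD : D ≠ 0)
    (hu : ‖u - p‖ ≤ (D : ℝ) / 2) {X : ℕ → ℕ} (hX : ∀ n, D * (k + 1) ≤ X n + 1) :
    ∃ n₀ ≤ beta D (32 * (k + 1) ^ 2 - 1) X, ∃ T S : ℝ, 1 ≤ T ∧ 0 < S ∧
      24 * (D : ℝ) * T * ((k : ℝ) + 1) ≤ (n₀ : ℝ) + 1 ∧ (D : ℝ) * ((X n₀ : ℝ) + 1) ≤ S ∧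
      ‖resolventFun A (S / c) u - resolventFun A (T / c) u‖ ≤
        1 / (32 * (D : ℝ) * ((k : ℝ) + 1)) := by
  have hD' : (1 : ℝ) ≤ D := by exact_mod_cast Nat.one_le_iff_ne_zero.2 hD
  have hc' : (0 : ℝ) < c := by positivity
  set K := 32 * (k + 1) ^ 2 - 1 with hK
  have hK1 : K + 1 = 32 * (k + 1) ^ 2 := by
    have : 0 < 32 * (k + 1) ^ 2 := by positivity
    omega
  set R := 4 * D ^ 4 * (K + 1) ^ 2 with hR
  have hR0 : 0 < R := by positivity
  set m : ℕ → ℕ := fun i => (wFun D X)^[i] 0 with hm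
  have hmm : Monotone m := wFun_iterate_mono D X
  have hm1 : ∀ i, m (i + 1) = wFun D X (m i) := fun i => Function.iterate_succ_apply' _ _ _
  set T : ℕ → ℝ := fun i => D * ((m i : ℝ) + 1) with hT
  have hT1 : ∀ i, 1 ≤ T i := fun i =>
    one_le_mul_of_one_le_of_one_le hD' (by linarith [Nat.cast_nonneg (α := ℝ) (m i)])
  have hTc : ∀ i, 0 < T i / c := fun i => div_pos (by linarith [hT1 i]) hc'
  set x : ℕ → H := fun i => resolventFun A (T i / c) u with hx
  have hux : ∀ i, ‖u - x i‖ ^ 2 ≤ (D : ℝ) ^ 2 / 4 := by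
    intro i
    have h1 := (hA.norm_sub_resolventFun_le hp (hTc i) u).trans hu
    calc ‖u - x i‖ ^ 2 ≤ ((D : ℝ) / 2) ^ 2 := by gcongr
      _ = _ := by ring
  -- The index is shifted by one because m 0 = 0 is too small: m + 1 ≥ D(k + 1) is guaranteed only
  -- after one application of `wFun`.
  obtain ⟨i, hiR, hi⟩ := exists_sub_succ_le (b := fun i => (D : ℝ) ^ 2 / 4 - ‖u - x (i + 1)‖ ^ 2)
    (M := (D : ℝ) ^ 2 / 4) (fun i => sub_nonneg.2 (hux _))
    (fun i => by linarith [sq_nonneg ‖u - x (i + 1)‖]) hR0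
  have hclose := hA.norm_resolventFun_sub_resolventFun_sq_le (hTc (i + 1))
    (show T (i + 1) / c ≤ T (i + 1 + 1) / c by
      have : (m (i + 1) : ℝ) ≤ m (i + 1 + 1) := by exact_mod_cast hmm (Nat.le_succ _)
      simp only [hT]
      gcongr) u
  refine ⟨24 * D * (m (i + 1) + 1) ^ 2, ?_, T (i + 1), T (i + 1 + 1), hT1 _,
    by linarith [hT1 (i + 1 + 1)], ?_, ?_, ?_⟩
  · unfold beta
    gcongr
    exact hmm (show i + 1 ≤ R by omega)
  · have h1 : D * (k + 1) ≤ m (i + 1) + 1 :=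
      (hX (24 * D * (m i + 1) ^ 2)).trans (by rw [hm1]; exact Nat.succ_le_succ (le_max_left _ _))
    have h2 : 24 * D * (D * (m (i + 1) + 1)) * (k + 1) ≤ 24 * D * (m (i + 1) + 1) ^ 2 + 1 := by
      calc 24 * D * (D * (m (i + 1) + 1)) * (k + 1)
          = 24 * D * (m (i + 1) + 1) * (D * (k + 1)) := by ring
        _ ≤ 24 * D * (m (i + 1) + 1) * (m (i + 1) + 1) := Nat.mul_le_mul_left _ h1
        _ = 24 * D * (m (i + 1) + 1) ^ 2 := by ring
        _ ≤ _ := Nat.le_succ _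
    simp only [hT]
    exact_mod_cast h2
  · have h1 : X (24 * D * (m (i + 1) + 1) ^ 2) ≤ m (i + 1 + 1) := by
      rw [hm1 (i + 1)]
      exact le_max_left _ _
    simp only [hT]
    gcongr
  · have h1 : (D : ℝ) ^ 2 / 4 / R = (1 / (128 * (D : ℝ) * ((k : ℝ) + 1) ^ 2)) ^ 2 := by
      rw [hR, hK1]
      push_cast
      field_simp
      norm_num
    have h2 : ‖x (i + 1 + 1) - x (i + 1)‖ ^ 2 ≤ (1 / (128 * (D : ℝ) * ((k : ℝ) + 1) ^ 2)) ^ 2 := by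
      rw [← h1]
      refine hclose.trans ?_
      linarith
    refine (sq_le_sq₀ (norm_nonneg _) (by positivity) |>.1 h2).trans ?_
    have hk : (1 : ℝ) ≤ (k : ℝ) + 1 := by linarith [Nat.cast_nonneg (α := ℝ) k]
    gcongr
    · norm_num
    · exact le_self_pow₀ hk two_ne_zero

theorem Xi_add_one_ge {c : ℕ} (hc : c ≠ 0) {C h : ℕ → ℕ} (hC0 : ∀ n, C n ≠ 0)
    (hhpos : ∀ n, h n ≠ 0) (k : ℕ) (f l L : ℕ → ℕ) (D n : ℕ) :
    D * (k + 1) ≤ Xi k f c C l L D h n + 1 := by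
  set P := Phi k c f l L D n with hP
  have h1 : xi k f c C D h P ≤ Xi k f c C l L D h n := le_max_right _ _
  refine le_trans ?_ (Nat.succ_le_succ h1)
  unfold xi
  rw [Nat.succ_eq_add_one, zeta_add_one hc hC0]
  set M := max (16 * h (f P) * (k + 1) ^ 2 * (6 * D + 1))
    (4 * c * (r2 k D P) ^ 2 * (6 * D + 1)) with hM
  have hh0 := hhpos (f P)
  calc D * (k + 1) ≤ D * (k + 1) ^ 2 := Nat.mul_le_mul_left _ (Nat.le_self_pow two_ne_zero _)
    _ = (k + 1) ^ 2 * D := mul_comm _ _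
    _ ≤ 16 * h (f P) * (k + 1) ^ 2 * (6 * D + 1) :=
        Nat.mul_le_mul (Nat.le_mul_of_pos_left _ (by positivity)) (by omega)
    _ ≤ M := le_max_left _ _
    _ ≤ M + 1 := Nat.le_succ _
    _ ≤ c * (M + 1) := Nat.le_mul_of_pos_left _ (by positivity)
    _ ≤ c * (M + 1) * C (f P) := Nat.le_mul_of_pos_right _ (Nat.pos_of_ne_zero (hC0 _))

theorem norm_iterate_sub_le {A : H → Set H} (hA : IsMaximalMonotoneOp A)
    {cs lam gam del : ℕ → ℝ} (hcs : ∀ n, 0 < cs n) (hlam : ∀ n, 0 ≤ lam n)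
    (hgam : ∀ n, 0 ≤ gam n) (hdel : ∀ n, 0 ≤ del n) (hsum : ∀ n, lam n + gam n + del n = 1)
    {u : H} {y : ℕ → H}
    (hy : ∀ n, y (n + 1) = lam n • u + gam n • y n + del n • resolventFun A (cs n) (y n))
    {p : H} (hp : p ∈ zeros A) {D : ℝ} (hu : ‖u - p‖ ≤ D) (hy0 : ‖y 0 - p‖ ≤ D) (n : ℕ) :
    ‖y n - p‖ ≤ D := by
  induction n with
  | zero => exact hy0
  | succ n ih =>
    have h1 : y (n + 1) - p =
        lam n • (u - p) + gam n • (y n - p) + del n • (resolventFun A (cs n) (y n) - p) := by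
      have h2 : p = (lam n + gam n + del n) • p := by rw [hsum, one_smul]
      rw [hy]
      nth_rewrite 1 [h2]
      simp only [smul_sub, add_smul]
      abel
    have h3 := (hA.norm_resolventFun_sub_le hp (hcs n) (y n)).trans ih
    rw [h1]
    refine (norm_add₃_le).trans ?_
    rw [norm_smul, norm_smul, norm_smul, Real.norm_of_nonneg (hlam n),
      Real.norm_of_nonneg (hgam n), Real.norm_of_nonneg (hdel n)]
    have h4 := mul_le_mul_of_nonneg_left hu (hlam n)
    have h5 := mul_le_mul_of_nonneg_left ih (hgam n)
    have h6 := mul_le_mul_of_nonneg_left h3 (hdel n)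
    have h7 : lam n * D + gam n * D + del n * D = D := by rw [← add_mul, ← add_mul, hsum, one_mul]
    linarith

/-- The variational inequality at an almost fixed point. -/
theorem inner_step_le {A : H → Set H} (hA : IsMaximalMonotoneOp A) {σ lam gam del T D κ ν c : ℝ}
    {u x y w : H} (hσ : 1 / c ≤ σ) (hc : 0 < c) (hlam : 0 ≤ lam) (hgam : 0 ≤ gam)
    (hgam1 : gam ≤ 1)
    (hsum : lam + gam + del = 1) (hD : 0 < D) (hT : 1 ≤ T) (hκ : 1 ≤ κ) (hν : 0 < ν)
    {b : H} (hb : b ∈ A w) (hbw : w + σ • b = y)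
    (hux : ‖u - x‖ ≤ D / 2) (huz : ‖u - resolventFun A (T / c) u‖ ≤ D / 2)
    (hwx : ‖w - x‖ ≤ 3 * (D / 2)) (hwz : ‖w - resolventFun A (T / c) u‖ ≤ 3 * (D / 2))
    (huw : ‖u - w‖ ≤ 3 * (D / 2))
    (hxz : ‖x - resolventFun A (T / c) u‖ ≤ 1 / (32 * D * κ))
    (hlam1 : lam ≤ 1 / (256 * D ^ 2 * κ ^ 2)) (hyw : ‖y - w‖ ≤ 1 / (2 * ν))
    (hνT : 24 * D * T * κ ≤ ν) :
    inner ℝ (u - x) (lam • u + gam • y + del • w - x) ≤ 1 / (9 * κ) := by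
  have hκ0 : 0 < κ := by linarith
  have hT0 : 0 < T := by linarith
  have hσ0 : 0 < σ := lt_of_lt_of_le (by positivity) hσ
  have hbn : ‖b‖ ≤ c * (1 / (2 * ν)) := by
    have h1 : σ * ‖b‖ = ‖y - w‖ := by
      rw [← hbw, add_sub_cancel_left, norm_smul, Real.norm_of_nonneg hσ0.le]
    have h2 := mul_le_mul_of_nonneg_right hσ (norm_nonneg b)
    rw [one_div, inv_mul_le_iff₀ hc] at h2
    exact h2.trans (by gcongr; linarith)
  have h1 : inner ℝ (u - resolventFun A (T / c) u) (w - resolventFun A (T / c) u) ≤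
      1 / (32 * κ) := by
    refine (hA.inner_resolventFun_le (div_pos hT0 hc) u hb).trans ?_
    calc _ ≤ T / c * (c * (1 / (2 * ν)) * (3 * (D / 2))) := by gcongr
      _ ≤ T / c * (c * (1 / (2 * (24 * D * T * κ))) * (3 * (D / 2))) := by gcongr
      _ = 1 / (32 * κ) := by field_simp; norm_num
  have h2 := inner_sub_le_add h1 huz hwx
  have h3 : 4 * (D / 2) * ‖x - resolventFun A (T / c) u‖ ≤ 1 / (16 * κ) := by
    calc _ ≤ 4 * (D / 2) * (1 / (32 * D * κ)) := by gcongr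
      _ = _ := by field_simp; norm_num
  -- The next iterate differs from the resolvent value w only by terms controlled by λ and ‖y - w‖,
  -- so the variational inequality at w transfers.
  have h4 : lam • u + gam • y + del • w - x = (w - x) + (lam • (u - w) + gam • (y - w)) := by
    have : w = (lam + gam + del) • w := by rw [hsum, one_smul]
    nth_rewrite 2 [this]
    simp only [smul_sub, add_smul]
    abel
  have h5 : inner ℝ (u - x) (lam • (u - w) + gam • (y - w)) ≤
      D / 2 * (lam * (3 * (D / 2)) + 1 / (2 * ν)) := by
    refine (real_inner_le_norm _ _).trans (mul_le_mul hux ?_ (norm_nonneg _) (by positivity))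
    refine (norm_add_le _ _).trans ?_
    rw [norm_smul, norm_smul, Real.norm_of_nonneg hlam, Real.norm_of_nonneg hgam]
    have := mul_le_mul_of_nonneg_left huw hlam
    have := mul_le_mul hgam1 hyw (norm_nonneg _) zero_le_one
    linarith
  have h6 : D / 2 * (lam * (3 * (D / 2)) + 1 / (2 * ν)) ≤ 3 / (1024 * κ) + 1 / (96 * κ) := by
    have h7 : D / 2 * (lam * (3 * (D / 2))) ≤ 3 / (1024 * κ) := by
      calc _ ≤ D / 2 * (1 / (256 * D ^ 2 * κ ^ 2) * (3 * (D / 2))) := by gcongr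
        _ ≤ D / 2 * (1 / (256 * D ^ 2 * κ) * (3 * (D / 2))) := by
            gcongr
            exact le_self_pow₀ hκ two_ne_zero
        _ = _ := by field_simp; norm_num
    have h8 : D / 2 * (1 / (2 * ν)) ≤ 1 / (96 * κ) := by
      have h9 : 24 * D * κ ≤ ν := by
        refine le_trans ?_ hνT
        have : 24 * D * κ * 1 ≤ 24 * D * κ * T := by gcongr
        linarith
      calc _ ≤ D / 2 * (1 / (2 * (24 * D * κ))) := by gcongr
        _ = _ := by field_simp; norm_num
    linarith
  rw [h4, inner_add_right]
  set ρ := 1 / κ with hρ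
  have hρ0 : 0 < ρ := by positivity
  have e1 : 1 / (32 * κ) = ρ / 32 := by rw [hρ]; field_simp
  have e2 : 1 / (16 * κ) = ρ / 16 := by rw [hρ]; field_simp
  have e3 : 1 / (96 * κ) = ρ / 96 := by rw [hρ]; field_simp
  have e4 : 3 / (1024 * κ) = 3 * ρ / 1024 := by rw [hρ]; field_simp
  have e5 : 1 / (9 * κ) = ρ / 9 := by rw [hρ]; field_simp
  rw [e5]
  rw [e1] at h2
  rw [e2] at h3
  rw [e3, e4] at h6
  -- The budget is 1/32 + 1/16 + 3/1024 + 1/96 < 1/9.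
  linarith

/-- The iteration stays metastably close to a point of the resolvent curve through `u`. -/
theorem exists_forall_norm_sub_sq_le
    {A : H → Set H} (hA : IsMaximalMonotoneOp A)
    {cs lam gam del : ℕ → ℝ}
    (hcs : ∀ n, 0 < cs n)
    (hlam : ∀ n, lam n ∈ Set.Ioo (0 : ℝ) 1)
    (hgam : ∀ n, gam n ∈ Set.Ico (0 : ℝ) 1)
    (hdel : ∀ n, del n ∈ Set.Ioo (0 : ℝ) 1)
    (hsum : ∀ n, lam n + gam n + del n = 1)
    {u : H} {y : ℕ → H}
    (hy : ∀ n, y (n + 1) = lam n • u + gam n • y n + del n • resolventFun A (cs n) (y n))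
    {c : ℕ} (hc : c ≠ 0)
    {h l L : ℕ → ℕ} (hh : Monotone h) (hl : Monotone l) (hL : Monotone L)
    (hhpos : ∀ n, h n ≠ 0)
    (hQ1 : ∀ n, 1 / (h n : ℝ) ≤ lam n)
    (hQ2 : ∀ k n, l k ≤ n → lam n ≤ 1 / ((k : ℝ) + 1))
    (hQ3 : ∀ k : ℕ, (k : ℝ) ≤ ∑ i ∈ Finset.Icc 1 (L k), lam i)
    (hQ4 : ∀ n, 1 / (c : ℝ) ≤ min (cs n) ((del n) ^ 2))
    {D : ℕ} (hD : D ≠ 0)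
    {p : H} (hp : p ∈ zeros A)
    (hDp : max (2 * ‖u - p‖) ‖y 0 - p‖ ≤ (D : ℝ))
    {C : ℕ → ℕ} (hC : Monotone C) (hcC : ∀ n, cs n ≤ (C n : ℝ))
    (k : ℕ) {f : ℕ → ℕ} (hf : Monotone f) :
    ∃ x : H, ∃ n ≤ mu c C h l L D k f,
      ∀ i ∈ Set.Icc n (f n), ‖y i - x‖ ^ 2 ≤ 1 / ((k : ℝ) + 1) := by
  have hD' : (0 : ℝ) < D := by positivity
  have hc' : (0 : ℝ) < c := by positivity
  have hC0 : ∀ n, C n ≠ 0 := fun n h0 => by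
    have h1 := hcC n
    have h2 := hcs n
    rw [h0, Nat.cast_zero] at h1
    linarith
  have hu : ‖u - p‖ ≤ (D : ℝ) / 2 := by linarith [(le_max_left _ _).trans hDp]
  have hyp : ∀ n, ‖y n - p‖ ≤ D := norm_iterate_sub_le hA hcs (fun n => (hlam n).1.le)
    (fun n => (hgam n).1) (fun n => (hdel n).1.le) hsum hy hp (by linarith)
    ((le_max_right _ _).trans hDp)
  obtain ⟨n₀, hn₀, T, S, hT, hS, hn₀T, hXS, hST⟩ := hA.exists_resolventFun_close hp hc hD hu
    (Xi_add_one_ge hc hC0 hhpos k f l L D)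
  have hSc : 0 < S / c := by positivity
  have hTc : 0 < T / c := div_pos (by linarith) hc'
  obtain ⟨a, ha, hau⟩ := hA.resolventFun_spec hSc u
  choose b hb hby using fun n => hA.resolventFun_spec (hcs n) (y n)
  have hux := (hA.norm_sub_resolventFun_le hp hSc u).trans hu
  have huz := (hA.norm_sub_resolventFun_le hp hTc u).trans hu
  have hxp := (hA.norm_resolventFun_sub_le hp hSc u).trans hu
  have hzp := (hA.norm_resolventFun_sub_le hp hTc u).trans hu
  have hwp := fun n => (hA.norm_resolventFun_sub_le hp (hcs n) (y n)).trans (hyp n)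
  have htri : ∀ q r : H, ‖q - p‖ ≤ D → ‖r - p‖ ≤ (D : ℝ) / 2 → ‖q - r‖ ≤ 3 * ((D : ℝ) / 2) := by
    intro q r hq hr
    have := norm_sub_le (q - p) (r - p)
    rw [sub_sub_sub_cancel_right] at this
    linarith
  set x := resolventFun A (S / c) u with hx
  set w : ℕ → H := fun n => resolventFun A (cs n) (y n) with hw
  have hyx : ∀ n, ‖y n - x‖ ≤ 3 * ((D : ℝ) / 2) := fun n => htri _ _ (hyp n) hxp
  have hwx : ∀ n, ‖w n - x‖ ≤ 3 * ((D : ℝ) / 2) := fun n => htri _ _ (hwp n) hxp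
  have hanorm : ‖a‖ * S ≤ c * (D / 2) := by
    have h1 : S / c * ‖a‖ = ‖u - x‖ := by
      rw [← hau, add_sub_cancel_left, norm_smul, Real.norm_of_nonneg hSc.le]
    calc ‖a‖ * S = c * (S / c * ‖a‖) := by field_simp
      _ ≤ _ := by rw [h1]; gcongr
  set X := Xi k f c C l L D h with hX
  have haX : ‖a‖ * ((X n₀ : ℝ) + 1) ≤ c := by
    have h1 : ‖a‖ * (D * ((X n₀ : ℝ) + 1)) ≤ ‖a‖ * S := by gcongr
    have h2 : (D : ℝ) * (‖a‖ * ((X n₀ : ℝ) + 1)) ≤ D * c := by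
      have := mul_pos hD' hc'
      linarith
    exact le_of_mul_le_mul_left h2 hD'
  obtain ⟨n, hn, hwin⟩ := exists_le_forall_le (lam := lam) (a := fun n => ‖y n - x‖ ^ 2)
    (s := fun n => inner ℝ (u - x) (y n - x)) (e := fun n => 2 * (cs n * (‖a‖ * (3 * (D / 2)))))
    (d := fun n => ‖y n - w n‖) (k := k) (n₀ := n₀)
    hD hc hh hl hL hC hf hC0 hhpos (fun n => (hlam n).1) (fun n => (hlam n).2.le) hQ1 hQ2 hQ3
    (fun n => sq_nonneg _)
    (fun n => by
      calc ‖y n - x‖ ^ 2 ≤ (2 * (D : ℝ)) ^ 2 := by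
            gcongr
            linarith [hyx n]
        _ = _ := by ring)
    (fun n => by
      refine (real_inner_le_norm _ _).trans ?_
      calc ‖u - x‖ * ‖y n - x‖ ≤ (D : ℝ) / 2 * (3 * (D / 2)) := by
            gcongr
            exact hyx n
        _ ≤ (D : ℝ) ^ 2 := by nlinarith)
    (fun n => by
      have h1 := norm_step_sq_le (hA.1 _ _ _ _ (hb n) ha) (hby n) (u := u) (hcs n).le
        (hlam n).1.le (hlam n).2.le (hgam n).1 (hdel n).1.le (hsum n) (hwx n)
      rw [← hy n] at h1
      have h2 : ‖y n - w n‖ ^ 2 / c ≤ del n ^ 2 * ‖y n - w n‖ ^ 2 := by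
        rw [div_eq_mul_one_div, mul_comm]
        gcongr
        exact (hQ4 n).trans (min_le_right _ _)
      linarith)
    (fun n hl1 hd => by
      rw [hy n]
      refine inner_step_le hA (ν := (n₀ : ℝ) + 1) ((hQ4 n).trans (min_le_left _ _)) hc'
        (hlam n).1.le (hgam n).1 (hgam n).2.le (hsum n) hD' hT
        (by linarith [Nat.cast_nonneg (α := ℝ) k]) (by positivity) (hb n) (hby n) hux huz (hwx n)
        (htri _ _ (hwp n) hzp) ?_ hST hl1
        (sq_le_sq₀ (norm_nonneg _) (by positivity) |>.1 hd) hn₀T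
      rw [norm_sub_rev]
      exact htri _ _ (hwp n) hu)
    (fun n => by have := hcs n; positivity)
    (fun n => by
      have h1 := hcs n
      calc 2 * (cs n * (‖a‖ * (3 * ((D : ℝ) / 2)))) * ((X n₀ : ℝ) + 1)
          = 3 * D * cs n * (‖a‖ * ((X n₀ : ℝ) + 1)) := by ring
        _ ≤ 3 * D * C n * c := by gcongr; exact hcC n
        _ = 3 * D * c * C n := by ring)
  refine ⟨x, n, hn.trans ?_, hwin⟩
  -- The index n₀ is known only up to n₀ ≤ b, so the bound is pushed to b; `Xi` itself need not be
  -- monotone, as it is only used at n₀.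
  have hphi := phi2_mono (fTildeAddTwo_mono hL hf D k) D (r1_mono c hn₀) (r3_mono hl k c D hn₀)
  exact max_le_max (sigmaBar_mono hL D k hphi) (fTildeAddTwo_mono hL hf D k hphi)

end Main

end MPPA

theorem mainTheorem4 {H : Type*} [NormedAddCommGroup H] [InnerProductSpace ℝ H]
    [CompleteSpace H]
    (A : H → Set H) (hA : MPPA.IsMaximalMonotoneOp A)
    (cs lam gam del : ℕ → ℝ)
    (hcs : ∀ n, 0 < cs n)
    (hlam : ∀ n, lam n ∈ Set.Ioo (0 : ℝ) 1)
    (hgam : ∀ n, gam n ∈ Set.Ico (0 : ℝ) 1)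
    (hdel : ∀ n, del n ∈ Set.Ioo (0 : ℝ) 1)
    (hsum : ∀ n, lam n + gam n + del n = 1)
    (u : H) (y : ℕ → H)
    (hy : ∀ n, y (n + 1) =
      lam n • u + gam n • y n + del n • MPPA.resolventFun A (cs n) (y n))
    (c : ℕ) (hc : c ≠ 0)
    (h l L : ℕ → ℕ) (hh : Monotone h) (hl : Monotone l) (hL : Monotone L)
    (hhpos : ∀ n, h n ≠ 0)
    (hQ1 : ∀ n, 1 / (h n : ℝ) ≤ lam n)
    (hQ2 : ∀ k n, l k ≤ n → lam n ≤ 1 / ((k : ℝ) + 1))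
    (hQ3 : ∀ k : ℕ, (k : ℝ) ≤ ∑ i ∈ Finset.Icc 1 (L k), lam i)
    (hQ4 : ∀ n, 1 / (c : ℝ) ≤ min (cs n) ((del n) ^ 2))
    (D : ℕ) (hD : D ≠ 0)
    (p : H) (hp : p ∈ MPPA.zeros A)
    (hDp : max (2 * ‖u - p‖) ‖y 0 - p‖ ≤ (D : ℝ))
    (C : ℕ → ℕ) (hC : Monotone C) (hcC : ∀ n, cs n ≤ (C n : ℝ))
    (k : ℕ) (f : ℕ → ℕ) (hf : Monotone f) :
    ∃ n ≤ MPPA.mu c C h l L D (4 * (k + 1) ^ 2 - 1) f,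
      ∀ i ∈ Set.Icc n (f n), ∀ j ∈ Set.Icc n (f n), ‖y i - y j‖ ≤ 1 / ((k : ℝ) + 1) := by

  -- Precision 4(k + 1)² for squared distances gives 1/(2(k + 1)) for distances to x, half the
  -- allowance for each of `y i` and `y j`.
  obtain ⟨x, n, hn, hx⟩ := MPPA.exists_forall_norm_sub_sq_le hA hcs hlam hgam hdel hsum hy hc hh hl
    hL hhpos hQ1 hQ2 hQ3 hQ4 hD hp hDp hC hcC (4 * (k + 1) ^ 2 - 1) hf
  have hK : ((4 * (k + 1) ^ 2 - 1 : ℕ) : ℝ) + 1 = (2 * ((k : ℝ) + 1)) ^ 2 := by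
    rw [Nat.cast_sub (Nat.one_le_iff_ne_zero.2 (by positivity))]
    push_cast
    ring
  have hhalf : ∀ i ∈ Set.Icc n (f n), ‖y i - x‖ ≤ 1 / (2 * ((k : ℝ) + 1)) := by
    intro i hi
    have h1 := hx i hi
    rw [hK, ← one_div_pow] at h1
    exact sq_le_sq₀ (norm_nonneg _) (by positivity) |>.1 h1
  refine ⟨n, hn, fun i hi j hj => ?_⟩
  have h1 := norm_sub_le (y i - x) (y j - x)
  rw [sub_sub_sub_cancel_right] at h1
  have h2 : 1 / (2 * ((k : ℝ) + 1)) + 1 / (2 * ((k : ℝ) + 1)) = 1 / ((k : ℝ) + 1) := by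
    field_simp
    norm_num
  linarith [hhalf i hi, hhalf j hj]
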